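/- Let $d\ge 2$ and let $e_2\in\mathbb{R}^d$ be the second standard unit vector. For $L>0$ and $x\in\mathbb{R}^d$ let $S_{x,L}$ be the stick of length $L$ and radius $1$ centred at $x$ and parallel to $e_2$, that is, the set of points of $\mathbb{R}^d$ at Euclidean distance at most $1$ from the segment $\{x+te_2:-L/2\le t\le L/2\}$. For $\lambda>0$ let $\Pi^\lambda$ be a homogeneous Poisson point process on $\mathbb{R}^d$ with intensity $\lambda$, and let $\mathcal{C}_L(\Pi^\lambda)=\bigcup_{x\in\Pi^\lambda}S_{x,L}$. Put \[ \lambda_{c,r}(L)=\inf\{\lambda>0:\ \mathbb{P}(\mathcal{C}_L(\Pi^\lambda)\text{ has an unbounded connected component})=1\}. \] Then there exist constants $0<c<C<\infty$, depending only on $d$, such that for every sufficiently large $L$ \[ cL^{-1}\le\lambda_{c,r}(L)\le CL^{-1}. \] -/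

import Mathlib

open MeasureTheory ProbabilityTheory
open scoped ENNReal NNReal

noncomputable section

namespace PoissonStick

/-- Euclidean space `ℝ^d` with the `L²`-norm. -/
abbrev E (d : ℕ) : Type := EuclideanSpace ℝ (Fin d)

/-- The unit sphere of `ℝ^d`. -/
abbrev Sph (d : ℕ) : Type := Metric.sphere (0 : E d) 1

/-- The centre line `{x + t p : -L/2 ≤ t ≤ L/2}` of a stick. -/
def axis {d : ℕ} (x : E d) (p : Sph d) (L : ℝ) : Set (E d) :=
  {y | ∃ t : ℝ, -(L / 2) ≤ t ∧ t ≤ L / 2 ∧ y = x + t • (p : E d)}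

/-- The stick of length `L` and radius `1`: all points at distance at most `1` from the
centre line. -/
def stick {d : ℕ} (x : E d) (p : Sph d) (L : ℝ) : Set (E d) :=
  Metric.cthickening 1 (axis x p L)

/-- Configurations: sets of pairs (centre, orientation) with only finitely many centres
in each bounded region. -/
def Config (d : ℕ) : Type :=
  {ω : Set (E d × Sph d) //
    ∀ A : Set (E d), Bornology.IsBounded A → (ω ∩ A ×ˢ (Set.univ : Set (Sph d))).Finite}

/-- The number of points of a configuration in a region. -/
def count {d : ℕ} (B : Set (E d × Sph d)) (ω : Config d) : ℕ∞ := (ω.1 ∩ B).encard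

/-- The usual `σ`-algebra on configurations, generated by the numbers of points in
measurable regions. -/
instance instMeasurableSpaceConfig (d : ℕ) : MeasurableSpace (Config d) :=
  ⨆ B : {B : Set (E d × Sph d) // MeasurableSet B},
    MeasurableSpace.comap (count B.1) inferInstance

theorem measurable_count {d : ℕ} {B : Set (E d × Sph d)} (hB : MeasurableSet B) :
    Measurable (count B) :=
  measurable_iff_comap_le.2 (le_iSup
    (fun B : {B : Set (E d × Sph d) // MeasurableSet B} =>
      MeasurableSpace.comap (count B.1) inferInstance) ⟨B, hB⟩)

/-- `Q` is the law of a Poisson point process with intensity measure `μ`: the number of points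
in a measurable region of finite intensity is Poisson with parameter the intensity of that region,
and the numbers of points in finitely many disjoint measurable regions are independent.
(For a given `μ` there is at most one such `Q`.) -/
structure IsPoissonLaw {d : ℕ} (μ : Measure (E d × Sph d)) (Q : Measure (Config d)) : Prop where
  isProbabilityMeasure : IsProbabilityMeasure Q
  map_count : ∀ B : Set (E d × Sph d), MeasurableSet B → μ B ≠ ∞ →
    Q.map (count B) = (poissonMeasure (μ B).toNNReal).map (fun n : ℕ => (n : ℕ∞))
  indep_count : ∀ (n : ℕ) (B : Fin n → Set (E d × Sph d)), (∀ i, MeasurableSet (B i)) →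
    (∀ i j, i ≠ j → Disjoint (B i) (B j)) → iIndepFun (fun i => count (B i)) Q

/-- The intensity measure `lam · Leb ⊗ Θ` of the stick process. -/
def intensity {d : ℕ} (Θ : Measure (Sph d)) (lam : ℝ) : Measure (E d × Sph d) :=
  (ENNReal.ofReal lam • (volume : Measure (E d))).prod Θ

/-- The occupied set: the union of all sticks of the configuration. -/
def occupied {d : ℕ} (L : ℝ) (ω : Config d) : Set (E d) :=
  ⋃ z ∈ ω.1, stick z.1 z.2 L

/-- The occupied set has an unbounded connected component. -/
def Percolates {d : ℕ} (L : ℝ) (ω : Config d) : Prop :=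
  ∃ x ∈ occupied L ω, ¬ Bornology.IsBounded (connectedComponentIn (occupied L ω) x)

/-- The critical intensity for orientation distribution `Θ` and stick length `L`: the infimum of
the intensities at which the Poisson stick model percolates almost surely. The quantifier over `Q`
only names the law of the Poisson point process, which is unique. -/
def lambdaC {d : ℕ} (Θ : Measure (Sph d)) (L : ℝ) : ℝ :=
  sInf {lam : ℝ | 0 < lam ∧ ∃ Q : Measure (Config d),
    IsPoissonLaw (intensity Θ lam) Q ∧ ∀ᵐ ω ∂Q, Percolates L ω}

/-- The second standard unit vector `e₂` as a point of the sphere. -/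
def e₂ (d : ℕ) (hd : 2 ≤ d) : Sph d :=
  ⟨EuclideanSpace.single (⟨1, hd⟩ : Fin d) (1 : ℝ), by simp⟩

/-- The critical intensity of the rigid model, in which all sticks have direction `e₂`. -/
def lambdaCr (d : ℕ) (hd : 2 ≤ d) (L : ℝ) : ℝ :=
  lambdaC (Measure.dirac (e₂ d hd)) L

end PoissonStick

end

/-! Compressing `e₂` by a factor of order `L` makes a stick comparable to a unit box, so percolation
is decided by the mean number of centres per box of side `L` along `e₂` and side of order `1`
otherwise. Both bounds compare the model with site percolation on such boxes, where a site is open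
if its box contains a centre; distinct boxes are independent.

Upper bound: with sides `L/2` and `1/(2d)`, sticks centred in the same box or in neighbouring boxes
intersect (`stick_inter_nonempty`). When the mean per box is at least `6`, the open boxes in a
planar quadrant percolate. This is proved by renormalisation: a `3 × 3` block is good if at most one
of its sites is closed. Neighbouring good blocks connect all their open sites
(`renorm.siteConn_of_adj`), so connectivity descends the scales. A bad block of level `n` forces
`2^n` closed sites in one of at most `81^(2^n)` patterns, which has probability at most `(81
e^{-6})^(2^n)`. By Borel–Cantelli the blocks at the corner are good from some level on
(`ae_percolates`), and this forces an unbounded cluster.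

Lower bound: with sides `L` and `1`, intersecting sticks have box indices differing by at most `2`.
There are at most `5^{dn}` chains of `n` such steps, and each self-avoiding one is fully occupied
with probability at most `(lam L)^{n+1}`. If `lam L < 5^{-d}`, all clusters are finite
(`ae_finite_reachable`) and the components are bounded (`not_percolates_of_finite`).

The critical value is an infimum over intensities for which a percolating Poisson law exists, so
such a law has to be constructed (`exists_isPoissonLaw`). Otherwise the set could be empty, with
infimum `0`. -/

namespace PoissonStick

/-! ### Poisson processes of finite total intensity. -/

section Block

variable {X : Type*} [MeasurableSpace X]

/-- Finite sequences of points of `X`. -/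
abbrev Block (X : Type*) : Type _ := Σ n : ℕ, (Fin n → X)

theorem measurable_block {Y : Type*} [MeasurableSpace Y] {f : Block X → Y}
    (hf : ∀ n, Measurable fun x : Fin n → X => f ⟨n, x⟩) : Measurable f := by
  intro s hs
  exact MeasurableSpace.measurableSet_iInf.2 fun n => hf n hs

/-- The inclusion of the sequences of length `n`. -/
def blockMk {X : Type*} (n : ℕ) (x : Fin n → X) : Block X := ⟨n, x⟩

theorem measurable_blockMk (n : ℕ) : Measurable (blockMk (X := X) n) :=
  fun _ hs => MeasurableSpace.measurableSet_iInf.1 hs n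

/-- The law of a Poisson number of independent points, with total intensity `ν`. -/
noncomputable def blockLaw (ν : Measure X) : Measure (Block X) :=
  -- The product of `n` copies of the unnormalised `ν` already carries the mass `ν(X)^n` of the
  -- Poisson weight.
  Measure.sum fun n : ℕ => ENNReal.ofReal (Real.exp (-ν.real Set.univ) / n.factorial) •
    (Measure.pi fun _ : Fin n => ν).map (blockMk n)

instance (ν : Measure X) [IsFiniteMeasure ν] : IsProbabilityMeasure (blockLaw ν) := by
  constructor
  have h := (hasSum_one_poissonMeasure (ν Set.univ).toNNReal)
  rw [blockLaw, Measure.sum_apply _ MeasurableSet.univ]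
  have h2 : ∀ n : ℕ, (ENNReal.ofReal (Real.exp (-ν.real Set.univ) / n.factorial) •
      (Measure.pi fun _ : Fin n => ν).map (blockMk n)) Set.univ =
      ENNReal.ofReal (Real.exp (-(ν Set.univ).toNNReal) * (ν Set.univ).toNNReal ^ n
        / n.factorial) := by
    intro n
    rw [Measure.smul_apply, Measure.map_apply (measurable_blockMk n) MeasurableSet.univ,
      Set.preimage_univ, Measure.pi_univ, Finset.prod_const, Finset.card_univ, Fintype.card_fin,
      smul_eq_mul]
    have h3 : ν Set.univ = ENNReal.ofReal (ν Set.univ).toReal :=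
      (ENNReal.ofReal_toReal (measure_ne_top _ _)).symm
    conv_lhs => rw [h3]
    rw [← ENNReal.ofReal_pow ENNReal.toReal_nonneg, ← ENNReal.ofReal_mul (by positivity)]
    congr 1
    simp only [measureReal_def, ENNReal.coe_toNNReal_eq_toReal]
    ring
  simp_rw [h2]
  rw [← ENNReal.ofReal_tsum_of_nonneg (fun n => by positivity) h.summable, h.tsum_eq,
    ENNReal.ofReal_one]

theorem ae_blockLaw {ν : Measure X} {p : Block X → Prop} (hp : MeasurableSet {b | p b})
    (h : ∀ n, ∀ᵐ x ∂(Measure.pi fun _ : Fin n => ν), p ⟨n, x⟩) : ∀ᵐ b ∂blockLaw ν, p b := by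
  rw [blockLaw, Measure.ae_sum_iff' hp]
  intro n
  refine Measure.ae_smul_measure ?_ _
  rw [ae_map_iff (measurable_blockMk n).aemeasurable hp]
  exact h n

/-- The generating functional. By Fubini the sequences of length `n` contribute `(∫ g)^n`, and the
weights turn the sum into an exponential series. -/
theorem integral_blockLaw (ν : Measure X) [IsFiniteMeasure ν] {g : X → ℂ} (hg : Measurable g)
    (hb : ∀ x, ‖g x‖ ≤ 1) :
    ∫ b, ∏ i, g (b.2 i) ∂blockLaw ν = Complex.exp (∫ x, (g x - 1) ∂ν) := by
  have hm : Measurable fun b : Block X => ∏ i, g (b.2 i) :=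
    measurable_block fun n =>
      Finset.measurable_prod (f := fun (i : Fin n) (x : Fin n → X) => g (x i)) Finset.univ
        fun i _ => hg.comp (measurable_pi_apply i)
  have hint : Integrable (fun b : Block X => ∏ i, g (b.2 i)) (blockLaw ν) := by
    refine Integrable.of_bound hm.aestronglyMeasurable 1 (Filter.Eventually.of_forall fun b => ?_)
    rw [norm_prod]
    exact Finset.prod_le_one (fun _ _ => norm_nonneg _) fun i _ => hb _
  have hgi : Integrable g ν :=
    Integrable.of_bound hg.aestronglyMeasurable 1 (Filter.Eventually.of_forall hb)
  have h1 := integral_sum_measure hint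
  rw [← blockLaw] at h1
  rw [h1, integral_sub hgi (integrable_const 1), integral_const, Complex.exp_sub]
  have h3 : Complex.exp (∫ x, g x ∂ν) = ∑' n : ℕ, (∫ x, g x ∂ν) ^ n / n.factorial := by
    rw [Complex.exp_eq_exp_ℂ, NormedSpace.exp_eq_tsum_div]
  rw [h3]
  simp only [integral_smul_measure]
  have h2 : ∀ n : ℕ, ∫ b, ∏ i, g (b.2 i) ∂((Measure.pi fun _ : Fin n => ν).map (blockMk n))
      = (∫ x, g x ∂ν) ^ n := by
    intro n
    rw [integral_map (measurable_blockMk n).aemeasurable hm.aestronglyMeasurable]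
    exact (integral_fintype_prod_eq_pow g).trans (by rw [Fintype.card_fin])
  simp_rw [h2]
  rw [← tsum_div_const]
  refine tsum_congr fun n => ?_
  rw [ENNReal.toReal_ofReal (by positivity)]
  simp only [Complex.real_smul, mul_one, Complex.ofReal_div, Complex.ofReal_exp,
    Complex.ofReal_neg, Complex.ofReal_natCast, Complex.exp_neg]
  field_simp

/-- The number of points of a block in `B`. -/
noncomputable def blockCount {X : Type*} (B : Set X) (b : Block X) : ℕ := by
  classical exact (Finset.univ.filter fun i => b.2 i ∈ B).card

theorem blockCount_eq_sum {X : Type*} (B : Set X) (b : Block X) :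
    blockCount B b = ∑ i, B.indicator (fun _ => 1) (b.2 i) := by
  classical
  rw [blockCount, Finset.card_filter]
  exact Finset.sum_congr rfl fun i _ => by simp [Set.indicator_apply]

theorem measurable_blockCount {B : Set X} (hB : MeasurableSet B) : Measurable (blockCount B) := by
  refine measurable_block fun n => ?_
  simp only [blockCount_eq_sum]
  refine Finset.measurable_sum (f := fun (i : Fin n) (x : Fin n → X) =>
    B.indicator (fun _ => 1) (x i)) Finset.univ fun i _ => ?_
  exact (measurable_const.indicator hB).comp (measurable_pi_apply i)

/-- The generating functional at `g = exp(i ∑ t_j 1_{B_j})`. Disjointness makes `g - 1` a sum of one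
term per `B j`, so the joint characteristic function splits into Poisson factors. -/
theorem integral_exp_blockCount (ν : Measure X) [IsFiniteMeasure ν] {ι : Type*} [Fintype ι]
    {B : ι → Set X} (hB : ∀ j, MeasurableSet (B j)) (hd : ∀ i j, i ≠ j → Disjoint (B i) (B j))
    (t : ι → ℝ) :
    ∫ b, Complex.exp ((∑ j, (blockCount (B j) b : ℝ) * t j : ℝ) * Complex.I) ∂blockLaw ν =
      Complex.exp (∑ j, (ν.real (B j) : ℂ) * (Complex.exp (t j * Complex.I) - 1)) := by
  set f : X → ℝ := fun x => ∑ j, (B j).indicator (fun _ => t j) x with hf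
  set g : X → ℂ := fun x => Complex.exp (f x * Complex.I) with hg
  have hfm : Measurable f :=
    Finset.measurable_sum _ fun j _ => measurable_const.indicator (hB j)
  have hgm : Measurable g := by fun_prop
  have h1 : ∀ b : Block X, Complex.exp ((∑ j, (blockCount (B j) b : ℝ) * t j : ℝ) * Complex.I)
      = ∏ i, g (b.2 i) := by
    intro b
    rw [hg, ← Complex.exp_sum, ← Finset.sum_mul, ← Complex.ofReal_sum]
    congr 3
    rw [hf, Finset.sum_comm]
    refine Finset.sum_congr rfl fun j _ => ?_
    rw [blockCount_eq_sum, Nat.cast_sum, Finset.sum_mul]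
    refine Finset.sum_congr rfl fun i _ => ?_
    by_cases h : b.2 i ∈ B j <;> simp [h]
  simp_rw [h1]
  rw [integral_blockLaw ν hgm fun x => (Complex.norm_exp_ofReal_mul_I _).le]
  congr 1
  have h2 : ∀ x, g x - 1 =
      ∑ j, (B j).indicator (fun _ => Complex.exp (t j * Complex.I) - 1) x := by
    intro x
    by_cases hx : ∃ j, x ∈ B j
    · obtain ⟨j, hj⟩ := hx
      have hne : ∀ i, i ≠ j → x ∉ B i := fun i hi hxi =>
        Set.disjoint_left.1 (hd i j hi) hxi hj
      rw [hg]
      simp only [hf]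
      rw [Finset.sum_eq_single j (fun i _ hi => by simp [hne i hi]) (by simp),
        Finset.sum_eq_single j (fun i _ hi => by simp [hne i hi]) (by simp)]
      simp [hj]
    · push Not at hx
      simp [hg, hf, hx]
  simp_rw [h2]
  rw [integral_finsetSum _ fun j _ => (integrable_const _).indicator (hB j)]
  refine Finset.sum_congr rfl fun j _ => ?_
  rw [integral_indicator_const _ (hB j), Complex.real_smul]

end Block

/-! ### Superposition of finitely many independent blocks. -/

section Superposition

variable {X : Type*} [MeasurableSpace X]

/-- The number of points in `B` of the first `K` blocks. -/
noncomputable def partialCount {X : Type*} (K : ℕ) (B : Set X) (ω : ℕ → Block X) : ℕ :=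
  ∑ k ∈ Finset.range K, blockCount B (ω k)

theorem partialCount_mono {X : Type*} (B : Set X) (ω : ℕ → Block X) :
    Monotone fun K => partialCount K B ω := fun _ _ h =>
  Finset.sum_le_sum_of_subset (Finset.range_mono h)

theorem measurable_partialCount (K : ℕ) {B : Set X} (hB : MeasurableSet B) :
    Measurable (partialCount K B) :=
  Finset.measurable_sum (f := fun k (ω : ℕ → Block X) => blockCount B (ω k)) _ fun k _ =>
    (measurable_blockCount hB).comp (measurable_pi_apply k)

/-- Independent blocks with intensities `ν k`. -/
noncomputable def blocksLaw (ν : ℕ → Measure X) [∀ k, IsFiniteMeasure (ν k)] :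
    Measure (ℕ → Block X) :=
  Measure.infinitePi fun k => blockLaw (ν k)

variable (ν : ℕ → Measure X) [∀ k, IsFiniteMeasure (ν k)]

instance : IsProbabilityMeasure (blocksLaw ν) := by
  unfold blocksLaw; infer_instance

theorem integral_exp_partialCount (K : ℕ) {ι : Type*} [Fintype ι]
    {B : ι → Set X} (hB : ∀ j, MeasurableSet (B j)) (hd : ∀ i j, i ≠ j → Disjoint (B i) (B j))
    (t : ι → ℝ) :
    ∫ ω, Complex.exp ((∑ j, (partialCount K (B j) ω : ℝ) * t j : ℝ) * Complex.I) ∂blocksLaw ν =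
      ∏ j, Complex.exp ((∑ k ∈ Finset.range K, (ν k).real (B j) : ℝ) *
        (Complex.exp (t j * Complex.I) - 1)) := by
  set f : Block X → ℂ := fun b =>
    Complex.exp ((∑ j, (blockCount (B j) b : ℝ) * t j : ℝ) * Complex.I) with hf
  have hfm : Measurable f := by
    have : ∀ j, Measurable fun b => (blockCount (B j) b : ℝ) := fun j =>
      measurable_from_top.comp (measurable_blockCount (hB j))
    fun_prop
  have h1 : ∀ ω : ℕ → Block X,
      Complex.exp ((∑ j, (partialCount K (B j) ω : ℝ) * t j : ℝ) * Complex.I) =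
        ∏ k : Fin K, f (ω k) := by
    intro ω
    rw [hf, ← Complex.exp_sum, ← Finset.sum_mul, ← Complex.ofReal_sum, Finset.sum_comm]
    congr 3
    refine Finset.sum_congr rfl fun j _ => ?_
    rw [partialCount, Nat.cast_sum, Finset.sum_mul,
      Finset.sum_range fun k => (blockCount (B j) (ω k) : ℝ) * t j]
  have hind : iIndepFun (fun (k : Fin K) (ω : ℕ → Block X) => ω k) (blocksLaw ν) :=
    (iIndepFun_infinitePi (P := fun k => blockLaw (ν k)) (X := fun _ b => b)
      fun _ => measurable_id).precomp Fin.val_injective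
  simp_rw [h1]
  rw [hind.integral_fun_prod_comp (f := fun _ => f)
    (fun k => (measurable_pi_apply (k : ℕ)).aemeasurable) fun k => hfm.aestronglyMeasurable]
  have h2 : ∀ k : Fin K, ∫ ω, f (ω k) ∂blocksLaw ν =
      Complex.exp (∑ j, ((ν k).real (B j) : ℂ) * (Complex.exp (t j * Complex.I) - 1)) := by
    intro k
    rw [← integral_exp_blockCount (ν k) hB hd t]
    have hk := measurePreserving_eval_infinitePi (fun k => blockLaw (ν k)) (k : ℕ)
    rw [← hk.map_eq, integral_map hk.measurable.aemeasurable hfm.aestronglyMeasurable]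
    rfl
  simp_rw [h2]
  rw [← Complex.exp_sum, ← Complex.exp_sum, Finset.sum_comm]
  congr 1
  refine Finset.sum_congr rfl fun j _ => ?_
  rw [Complex.ofReal_sum, Finset.sum_mul, Finset.sum_range]

theorem map_partialCount (K : ℕ) {B : Set X} (hB : MeasurableSet B) :
    (blocksLaw ν).map (fun ω => (partialCount K B ω : ℝ)) =
      (poissonMeasure (∑ k ∈ Finset.range K, (ν k B).toNNReal)).map (Nat.cast : ℕ → ℝ) := by
  have hm : Measurable fun ω => (partialCount K B ω : ℝ) :=
    measurable_from_top.comp (measurable_partialCount K hB)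
  have : IsProbabilityMeasure ((blocksLaw ν).map fun ω => (partialCount K B ω : ℝ)) :=
    Measure.isProbabilityMeasure_map hm.aemeasurable
  refine Measure.ext_of_charFun ?_
  ext t
  rw [charFun_map_cast_poissonMeasure, charFun_apply,
    integral_map hm.aemeasurable (by fun_prop)]
  have := integral_exp_partialCount ν K (ι := Unit) (B := fun _ => B) (fun _ => hB)
    (by simp) (fun _ => t)
  simp only [Finset.univ_unique, Finset.sum_singleton, Finset.prod_singleton] at this
  simp only [Real.inner_apply]
  convert this using 3
  simp [measureReal_def, ENNReal.coe_toNNReal_eq_toReal]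

theorem measure_le_partialCount (K : ℕ) {B : Set X} (hB : MeasurableSet B) (m : ℕ) :
    blocksLaw ν {ω | m ≤ partialCount K B ω} =
      poissonMeasure (∑ k ∈ Finset.range K, (ν k B).toNNReal) (Set.Ici m) := by
  have h := congrArg (fun μ => μ (Set.Ici (m : ℝ))) (map_partialCount ν K hB)
  have hm : Measurable fun ω => (partialCount K B ω : ℝ) :=
    measurable_from_top.comp (measurable_partialCount K hB)
  rw [Measure.map_apply hm measurableSet_Ici, Measure.map_apply measurable_from_top measurableSet_Ici] at h
  convert h using 2
  · ext; simp
  · ext; simp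

/-- Independence holds because the joint characteristic function is the product of the marginal
ones. -/
theorem iIndepFun_partialCount (K : ℕ) {ι : Type*} [Fintype ι]
    {B : ι → Set X} (hB : ∀ j, MeasurableSet (B j)) (hd : ∀ i j, i ≠ j → Disjoint (B i) (B j)) :
    iIndepFun (fun j ω => (partialCount K (B j) ω : ℝ)) (blocksLaw ν) := by
  have hm : ∀ j, Measurable fun ω => (partialCount K (B j) ω : ℝ) := fun j =>
    measurable_from_top.comp (measurable_partialCount K (hB j))
  rw [iIndepFun_iff_charFun_pi fun j => (hm j).aemeasurable]
  intro t
  have hm' : Measurable fun ω => WithLp.toLp 2 fun j => (partialCount K (B j) ω : ℝ) :=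
    (WithLp.measurable_toLp 2 _).comp (measurable_pi_lambda _ hm)
  rw [charFun_apply, integral_map hm'.aemeasurable (by fun_prop)]
  have h := integral_exp_partialCount ν K hB hd (fun j => t j)
  have h2 : ∀ j, charFun ((blocksLaw ν).map fun ω => (partialCount K (B j) ω : ℝ)) (t j) =
      Complex.exp ((∑ k ∈ Finset.range K, (ν k).real (B j) : ℝ) *
        (Complex.exp (t j * Complex.I) - 1)) := by
    intro j
    rw [map_partialCount ν K (hB j), charFun_map_cast_poissonMeasure]
    simp [measureReal_def, ENNReal.coe_toNNReal_eq_toReal]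
  simp_rw [h2]
  rw [← h]
  refine integral_congr_ae (Filter.Eventually.of_forall fun ω => ?_)
  simp only [PiLp.inner_apply, Real.inner_apply]

end Superposition

/-! ### Limits of increasing counts, and almost sure absence of repeated points. -/

theorem enat_generateFrom :
    (inferInstance : MeasurableSpace ℕ∞) =
      MeasurableSpace.generateFrom (Set.range fun m : ℕ => Set.Ici (m : ℕ∞)) := by
  refine le_antisymm (fun s _ => ?_) (MeasurableSpace.generateFrom_le fun s _ => trivial)
  have h1 : ∀ m : ℕ, MeasurableSet[MeasurableSpace.generateFrom
      (Set.range fun m : ℕ => Set.Ici (m : ℕ∞))] (Set.Ici (m : ℕ∞)) := fun m =>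
    MeasurableSpace.measurableSet_generateFrom ⟨m, rfl⟩
  rw [← Set.biUnion_of_singleton s]
  refine MeasurableSet.biUnion s.to_countable fun x _ => ?_
  induction x with
  | top =>
    have : ({⊤} : Set ℕ∞) = ⋂ m : ℕ, Set.Ici (m : ℕ∞) := by
      ext x
      simp only [Set.mem_singleton_iff, Set.mem_iInter, Set.mem_Ici]
      refine ⟨fun h m => h ▸ le_top, fun h => ?_⟩
      exact ENat.eq_top_iff_forall_ge.2 h
    rw [this]
    exact MeasurableSet.iInter h1
  | coe n =>
    have : ({(n : ℕ∞)} : Set ℕ∞) = Set.Ici (n : ℕ∞) \ Set.Ici ((n + 1 : ℕ) : ℕ∞) := by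
      ext x
      induction x with
      | top => simp
      | coe k =>
        simp only [Set.mem_singleton_iff, Set.mem_sdiff, Set.mem_Ici, Nat.cast_inj, Nat.cast_le]
        omega
    rw [this]
    exact (h1 n).diff (h1 (n + 1))

theorem isPiSystem_enat_Ici : IsPiSystem (Set.range fun m : ℕ => Set.Ici (m : ℕ∞)) := by
  rintro _ ⟨m, rfl⟩ _ ⟨n, rfl⟩ -
  refine ⟨max m n, ?_⟩
  ext x
  have : ((max m n : ℕ) : ℕ∞) = max (m : ℕ∞) n := Nat.mono_cast.map_max
  simp only [Set.mem_Ici, Set.mem_inter_iff, this, max_le_iff]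

theorem tendsto_poissonMeasure_Ici {r : ℕ → ℝ≥0} {a : ℝ≥0}
    (h : Filter.Tendsto r Filter.atTop (nhds a)) (m : ℕ) :
    Filter.Tendsto (fun K => poissonMeasure (r K) (Set.Ici m)) Filter.atTop
      (nhds (poissonMeasure a (Set.Ici m))) := by
  have h1 : ∀ r : ℝ≥0, poissonMeasure r (Set.Ici m) =
      1 - ∑ n ∈ Finset.range m, ENNReal.ofReal (Real.exp (-r) * r ^ n / n.factorial) := by
    intro r
    have : (Set.Ici m) = ((Finset.range m : Finset ℕ) : Set ℕ)ᶜ := by ext; simp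
    rw [this, prob_compl_eq_one_sub (Finset.measurableSet _), ← sum_measure_singleton]
    simp_rw [poissonMeasure_singleton]
  simp_rw [h1]
  refine ENNReal.Tendsto.sub tendsto_const_nhds ?_ (Or.inl ENNReal.one_ne_top)
  refine tendsto_finsetSum _ fun n _ => ENNReal.tendsto_ofReal ?_
  have : Continuous fun r : ℝ≥0 => Real.exp (-(r : ℝ)) * (r : ℝ) ^ n / n.factorial := by fun_prop
  exact (this.tendsto a).comp h

section Limit

variable {Ω : Type*} [MeasurableSpace Ω] {P : Measure Ω}

/-- Up to a null set the limit event is the increasing union of the finite-stage events: finitely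
many thresholds reached at various stages are all reached at the largest one. Upper rays form a
π-system generating the `σ`-algebra of `ℕ∞`, so this suffices to pass laws and independence to the
limit. -/
theorem tendsto_measure_le_of_mono {ι : Type*} [Finite ι] {Z : ι → Ω → ℕ∞} {N : ℕ → ι → Ω → ℕ}
    (hmono : ∀ i ω, Monotone fun K => N K i ω)
    (hZ : ∀ᵐ ω ∂P, ∀ i, ∀ m : ℕ, (m : ℕ∞) ≤ Z i ω ↔ ∃ K, m ≤ N K i ω)
    (s : Finset ι) (m : ι → ℕ) :
    Filter.Tendsto (fun K => P (⋂ i ∈ s, {ω | m i ≤ N K i ω})) Filter.atTop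
      (nhds (P (⋂ i ∈ s, {ω | (m i : ℕ∞) ≤ Z i ω}))) := by
  have hmono' : Monotone fun K => ⋂ i ∈ s, {ω | m i ≤ N K i ω} := fun K K' h =>
    Set.iInter₂_mono fun i _ ω (hω : m i ≤ N K i ω) => hω.trans (hmono i ω h)
  have h : P (⋂ i ∈ s, {ω | (m i : ℕ∞) ≤ Z i ω}) = P (⋃ K, ⋂ i ∈ s, {ω | m i ≤ N K i ω}) := by
    refine measure_congr ?_
    filter_upwards [hZ] with ω hω
    refine propext ?_
    change ω ∈ (⋂ i ∈ s, {ω | (m i : ℕ∞) ≤ Z i ω}) ↔ ω ∈ ⋃ K, ⋂ i ∈ s, {ω | m i ≤ N K i ω}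
    simp only [Set.mem_iInter, Set.mem_iUnion, Set.mem_ofPred_eq, hω]
    refine ⟨fun hK => ?_, fun ⟨K, hK⟩ i hi => ⟨K, hK i hi⟩⟩
    choose! K hK using hK
    exact ⟨s.sup K, fun i hi => (hK i hi).trans (hmono i ω (Finset.le_sup hi))⟩
  rw [h]
  exact tendsto_measure_iUnion_atTop hmono'

theorem iIndepFun_of_mono [IsProbabilityMeasure P] {ι : Type*} [Finite ι] {Z : ι → Ω → ℕ∞} {N : ℕ → ι → Ω → ℕ}
    (hZm : ∀ i, Measurable (Z i))
    (hmono : ∀ i ω, Monotone fun K => N K i ω)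
    (hZ : ∀ᵐ ω ∂P, ∀ i, ∀ m : ℕ, (m : ℕ∞) ≤ Z i ω ↔ ∃ K, m ≤ N K i ω)
    (hN : ∀ K, iIndepFun (fun i ω => (N K i ω : ℝ)) P) : iIndepFun Z P := by
  rw [iIndepFun_iff_iIndep]
  refine iIndepSets.iIndep (fun i => (hZm i).comap_le)
    (fun i => Set.preimage (Z i) '' (Set.range fun m : ℕ => Set.Ici (m : ℕ∞)))
    (fun i => isPiSystem_enat_Ici.comap (Z i)) (fun i => ?_) ?_
  · have h : ENat.instMeasurableSpace = _ := enat_generateFrom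
    rw [h]
    exact MeasurableSpace.comap_generateFrom
  rw [iIndepSets_iff]
  intro s f hf
  have : ∀ i, ∃ m : ℕ, i ∈ s → f i = {ω | (m : ℕ∞) ≤ Z i ω} := by
    intro i
    by_cases hi : i ∈ s
    · obtain ⟨_, ⟨m, rfl⟩, hm⟩ := hf i hi
      exact ⟨m, fun _ => hm.symm⟩
    · exact ⟨0, fun h => absurd h hi⟩
  choose m hm using this
  rw [Set.iInter₂_congr hm, Finset.prod_congr rfl fun i hi => congrArg P (hm i hi)]
  refine tendsto_nhds_unique (tendsto_measure_le_of_mono hmono hZ s m) ?_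
  have h1 : ∀ K, P (⋂ i ∈ s, {ω | m i ≤ N K i ω}) = ∏ i ∈ s, P {ω | m i ≤ N K i ω} := by
    intro K
    have := (hN K).measure_inter_preimage_eq_mul s (sets := fun i => Set.Ici (m i : ℝ))
      fun _ _ => measurableSet_Ici
    simpa [Set.preimage] using this
  simp_rw [h1]
  refine ENNReal.tendsto_finsetProd_of_ne_top _ (fun i _ => ?_) fun i _ => measure_ne_top _ _
  simpa using tendsto_measure_le_of_mono hmono hZ {i} m

theorem map_eq_poisson_of_mono [IsProbabilityMeasure P] {Z : Ω → ℕ∞} {N : ℕ → Ω → ℕ} (hZm : Measurable Z)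
    (hmono : ∀ ω, Monotone fun K => N K ω)
    (hZ : ∀ᵐ ω ∂P, ∀ m : ℕ, (m : ℕ∞) ≤ Z ω ↔ ∃ K, m ≤ N K ω) {r : ℕ → ℝ≥0} {a : ℝ≥0}
    (hr : Filter.Tendsto r Filter.atTop (nhds a))
    (hN : ∀ K m, P {ω | m ≤ N K ω} = poissonMeasure (r K) (Set.Ici m)) :
    P.map Z = (poissonMeasure a).map (fun n : ℕ => (n : ℕ∞)) := by
  have h1 : IsProbabilityMeasure (P.map Z) := Measure.isProbabilityMeasure_map hZm.aemeasurable
  have h2 : IsProbabilityMeasure ((poissonMeasure a).map fun n : ℕ => (n : ℕ∞)) :=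
    Measure.isProbabilityMeasure_map .of_discrete
  refine ext_of_generate_finite _ enat_generateFrom isPiSystem_enat_Ici ?_ (by simp)
  rintro _ ⟨m, rfl⟩
  rw [Measure.map_apply hZm .of_discrete, Measure.map_apply .of_discrete .of_discrete]
  have h3 := tendsto_measure_le_of_mono (ι := Unit) (Z := fun _ => Z) (N := fun K _ => N K)
    (P := P) (fun _ => hmono) (by simpa using hZ) Finset.univ (fun _ => m)
  simp only [Finset.mem_univ, Set.iInter_const, hN] at h3
  have h4 := tendsto_nhds_unique h3 (tendsto_poissonMeasure_Ici hr m)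
  refine h4.trans (congrArg _ ?_)
  ext x
  exact (Nat.cast_le (α := ℕ∞)).symm

end Limit

/-- `blockCount` counts with multiplicity while a configuration is a set; the two agree only without
repetitions. -/
theorem encard_range_inter {X : Type*} {b : Block X} (hb : Function.Injective b.2) (B : Set X) :
    (Set.range b.2 ∩ B).encard = blockCount B b := by
  classical
  have : Set.range b.2 ∩ B = b.2 '' ((Finset.univ.filter fun i => b.2 i ∈ B : Finset _) : Set _) := by
    ext x
    simp only [Set.mem_inter_iff, Set.mem_range, Finset.coe_filter, Finset.mem_univ, true_and,
      Set.mem_image, Set.mem_ofPred_eq]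
    constructor
    · rintro ⟨⟨i, rfl⟩, h⟩
      exact ⟨i, h, rfl⟩
    · rintro ⟨i, h, rfl⟩
      exact ⟨⟨i, rfl⟩, h⟩
  rw [this, hb.encard_image, Set.encard_coe_eq_coe_finsetCard, blockCount]

/-- With one coordinate fixed, another one equals it with measure zero, since `ν` has no atoms;
Fubini concludes. -/
theorem ae_pi_injective {X : Type*} [MeasurableSpace X] [MeasurableEq X] (ν : Measure X)
    [SigmaFinite ν] [NullSingletonClass ν] (n : ℕ) :
    ∀ᵐ x ∂(Measure.pi fun _ : Fin n => ν), Function.Injective x := by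
  have h : ∀ i j : Fin n, i ≠ j → ∀ᵐ x ∂(Measure.pi fun _ : Fin n => ν), x i ≠ x j := by
    intro i j hij
    cases n with
    | zero => exact i.elim0
    | succ m =>
      obtain ⟨j', rfl⟩ := Fin.exists_succAbove_eq hij.symm
      have hmp := measurePreserving_piFinSuccAbove (fun _ : Fin (m + 1) => ν) i
      have hS : MeasurableSet {p : X × (Fin m → X) | p.2 j' = p.1} :=
        measurableSet_eq_fun (by fun_prop) (by fun_prop)
      have h0 : (ν.prod (Measure.pi fun _ : Fin m => ν)) {p : X × (Fin m → X) | p.2 j' = p.1} = 0 :=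
        (Measure.measure_prod_null hS).2 (Filter.Eventually.of_forall fun y =>
          Measure.pi_hyperplane (fun _ : Fin m => ν) j' y)
      rw [← hmp.measure_preimage hS.nullMeasurableSet] at h0
      rw [ae_iff]
      refine measure_mono_null (fun x hx => ?_) h0
      exact (not_not.1 hx).symm
  have h' : ∀ᵐ x ∂(Measure.pi fun _ : Fin n => ν), ∀ i j : Fin n, i ≠ j → x i ≠ x j :=
    ae_all_iff.2 fun i => ae_all_iff.2 fun j => by
      by_cases hij : i = j
      · simp [hij]
      · simpa [hij] using h i j hij
  filter_upwards [h'] with x hx i j hij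
  by_contra hne
  exact hx i j hne hij

/-! ### Existence of the Poisson process, from independent shells. -/

section Existence

variable {d : ℕ}

/-- The points whose centre has norm in `[k, k + 1)`. -/
def shell (d k : ℕ) : Set (E d × Sph d) := {z | ⌊‖z.1‖⌋₊ = k}

theorem measurableSet_shell (k : ℕ) : MeasurableSet (shell d k) :=
  (Nat.measurable_floor.comp (measurable_norm.comp measurable_fst)) (measurableSet_singleton k)

/-- The sequences of blocks without repetitions with the `k`th block in the `k`th shell. -/
def goodBlocks (d : ℕ) : Set (ℕ → Block (E d × Sph d)) :=
  {ω | ∀ k, Function.Injective (ω k).2 ∧ ∀ i, (ω k).2 i ∈ shell d k}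

/-- The set of points of a sequence of blocks. -/
def blockPoints {X : Type*} (ω : ℕ → Block X) : Set X := ⋃ k, Set.range (ω k).2

theorem finite_blockPoints_inter {ω : ℕ → Block (E d × Sph d)} (hω : ω ∈ goodBlocks d)
    (A : Set (E d)) (hA : Bornology.IsBounded A) :
    (blockPoints ω ∩ A ×ˢ (Set.univ : Set (Sph d))).Finite := by
  obtain ⟨R, hR⟩ := hA.exists_norm_le
  refine (Set.Finite.biUnion (Finset.range (⌊R⌋₊ + 1)).finite_toSet
    fun k _ => Set.finite_range (ω k).2).subset ?_
  rintro z ⟨hz, hzA⟩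
  obtain ⟨k, i, rfl⟩ := Set.mem_iUnion.1 hz
  refine Set.mem_biUnion (x := k) ?_ ⟨i, rfl⟩
  have h1 : ⌊‖((ω k).2 i).1‖⌋₊ = k := (hω k).2 i
  have h2 := Nat.floor_le_floor (hR _ hzA.1)
  simp only [Finset.coe_range, Set.mem_Iio]
  omega

/-- The configuration of points of a good sequence of blocks. -/
def blockConfig (ω : ℕ → Block (E d × Sph d)) : Config d :=
  -- Bad sequences are sent to the empty configuration, so that local finiteness holds for every `ω`
  -- and not only almost surely.
  ⟨{z | ω ∈ goodBlocks d ∧ z ∈ blockPoints ω}, fun A hA => by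
    by_cases hω : ω ∈ goodBlocks d
    · simpa [hω] using finite_blockPoints_inter hω A hA
    · simp [hω]⟩

theorem measurableSet_goodBlock (k : ℕ) : MeasurableSet {b : Block (E d × Sph d) |
    Function.Injective b.2 ∧ ∀ i, b.2 i ∈ shell d k} := by
  refine MeasurableSpace.measurableSet_iInf.2 fun n => ?_
  change MeasurableSet {x : Fin n → E d × Sph d | Function.Injective x ∧ ∀ i, x i ∈ shell d k}
  have h1 : {x : Fin n → E d × Sph d | Function.Injective x} =
      ⋂ i, ⋂ j, {x | x i = x j → i = j} := by
    ext x; simp [Function.Injective]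
  have h2 : {x : Fin n → E d × Sph d | ∀ i, x i ∈ shell d k} =
      ⋂ i, (fun x => x i) ⁻¹' shell d k := by
    ext x; simp
  rw [Set.ofPred_and, h1, h2]
  refine MeasurableSet.inter ?_ ?_
  · refine MeasurableSet.iInter fun i => MeasurableSet.iInter fun j => ?_
    by_cases hij : i = j
    · simp [hij]
    · simp only [hij, imp_false]
      exact (measurableSet_eq_fun (measurable_pi_apply i) (measurable_pi_apply j)).compl
  · exact MeasurableSet.iInter fun i => measurable_pi_apply i (measurableSet_shell k)

theorem measurableSet_goodBlocks : MeasurableSet (goodBlocks d) := by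
  have : goodBlocks d = ⋂ k, (fun ω => ω k) ⁻¹' {b : Block (E d × Sph d) |
      Function.Injective b.2 ∧ ∀ i, b.2 i ∈ shell d k} := by
    ext ω; simp [goodBlocks]
  rw [this]
  exact MeasurableSet.iInter fun k => measurable_pi_apply k (measurableSet_goodBlock k)

theorem encard_iUnion_range_inter {ω : ℕ → Block (E d × Sph d)} (hω : ω ∈ goodBlocks d)
    (B : Set (E d × Sph d)) (K : ℕ) :
    ((⋃ k ∈ Finset.range K, Set.range (ω k).2) ∩ B).encard = partialCount K B ω := by
  induction K with
  | zero => simp [partialCount]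
  | succ K ih =>
    rw [Finset.range_add_one, Finset.set_biUnion_insert, Set.union_inter_distrib_right,
      Set.encard_union_eq, ih, encard_range_inter (hω K).1, partialCount, partialCount,
      Finset.sum_range_succ, Nat.cast_add, add_comm]
    rw [Set.disjoint_left]
    rintro z ⟨⟨i, rfl⟩, -⟩ ⟨hz, -⟩
    simp only [Set.mem_iUnion, Finset.mem_range] at hz
    obtain ⟨k, hk, j, hj⟩ := hz
    have h1 : _ = K := (hω K).2 i
    have h2 : _ = k := (hω k).2 j
    rw [hj] at h2
    omega

theorem le_count_blockConfig {ω : ℕ → Block (E d × Sph d)} (hω : ω ∈ goodBlocks d)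
    (B : Set (E d × Sph d)) (m : ℕ) :
    (m : ℕ∞) ≤ count B (blockConfig ω) ↔ ∃ K, m ≤ partialCount K B ω := by
  have h0 : count B (blockConfig ω) = (blockPoints ω ∩ B).encard := by
    simp [count, blockConfig, hω]
  rw [h0]
  constructor
  · intro h
    obtain ⟨t, ht, htm⟩ := Set.exists_subset_encard_eq h
    have hfin : t.Finite := Set.finite_of_encard_eq_coe htm
    lift t to Finset (E d × Sph d) using hfin
    have hk : ∀ z ∈ t, ∃ k, z ∈ Set.range (ω k).2 := fun z hz => Set.mem_iUnion.1 (ht hz).1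
    choose! k hk using hk
    refine ⟨t.sup k + 1, ?_⟩
    rw [← Nat.cast_le (α := ℕ∞), ← encard_iUnion_range_inter hω, ← htm]
    refine Set.encard_le_encard fun z hz => ⟨Set.mem_biUnion (x := k z) ?_ (hk z hz), (ht hz).2⟩
    exact Finset.mem_coe.2 (Finset.mem_range.2 (Nat.lt_succ_of_le (Finset.le_sup hz)))
  · rintro ⟨K, hK⟩
    rw [← Nat.cast_le (α := ℕ∞), ← encard_iUnion_range_inter hω] at hK
    refine hK.trans (Set.encard_le_encard (Set.inter_subset_inter_left _ ?_))
    exact Set.iUnion₂_subset fun k _ => Set.subset_iUnion (fun k => Set.range (ω k).2) k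

theorem measurable_count_blockConfig {B : Set (E d × Sph d)} (hB : MeasurableSet B) :
    Measurable fun ω => count B (blockConfig ω) := by
  have h : ENat.instMeasurableSpace = _ := enat_generateFrom
  rw [h]
  refine measurable_generateFrom ?_
  rintro _ ⟨m, rfl⟩
  cases m with
  | zero => simp
  | succ m =>
    have : (fun ω => count B (blockConfig ω)) ⁻¹' Set.Ici ((m + 1 : ℕ) : ℕ∞) =
        goodBlocks d ∩ ⋃ K, partialCount K B ⁻¹' Set.Ici (m + 1) := by
      ext ω
      by_cases hω : ω ∈ goodBlocks d
      · simpa [hω] using le_count_blockConfig hω B (m + 1)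
      · simp [hω, blockConfig, count]
    rw [this]
    exact measurableSet_goodBlocks.inter (MeasurableSet.iUnion fun K =>
      measurable_partialCount K hB .of_discrete)

theorem measurable_blockConfig : Measurable (blockConfig (d := d)) := by
  refine measurable_iff_comap_le.2 ?_
  rw [instMeasurableSpaceConfig, MeasurableSpace.comap_iSup]
  refine iSup_le fun B => ?_
  rw [MeasurableSpace.comap_comp]
  exact (measurable_count_blockConfig B.2).comap_le

theorem ae_mem_goodBlocks {ν : ℕ → Measure (E d × Sph d)} [∀ k, IsFiniteMeasure (ν k)]
    (h1 : ∀ k z, ν k {z} = 0) (h2 : ∀ k, ν k (shell d k)ᶜ = 0) :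
    ∀ᵐ ω ∂blocksLaw ν, ω ∈ goodBlocks d := by
  have hmeas := measurableSet_goodBlock (d := d)
  have hb : ∀ k, ∀ᵐ b ∂blockLaw (ν k),
      Function.Injective b.2 ∧ ∀ i, b.2 i ∈ shell d k := by
    intro k
    have : NullSingletonClass (ν k) := ⟨h1 k⟩
    have hs : ∀ n, ∀ᵐ x ∂(Measure.pi fun _ : Fin n => ν k), ∀ i, x i ∈ shell d k := fun n =>
      ae_all_iff.2 fun i => Measure.pi_eval_preimage_null (fun _ => ν k) (i := i) (h2 k)
    exact ae_blockLaw (hmeas k) fun n => (ae_pi_injective (ν k) n).and (hs n)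
  refine ae_all_iff.2 fun k => ?_
  exact (measurePreserving_eval_infinitePi (fun k => blockLaw (ν k)) k).quasiMeasurePreserving.ae
    (hb k)

/-- Existence of the Poisson point process with a diffuse, locally finite intensity measure. -/
theorem exists_isPoissonLaw (μ : Measure (E d × Sph d)) (h1 : ∀ z, μ {z} = 0)
    (h2 : ∀ k, μ (shell d k) ≠ ∞) : ∃ Q : Measure (Config d), IsPoissonLaw μ Q := by
  have hfin : ∀ k, IsFiniteMeasure (μ.restrict (shell d k)) := fun k =>
    ⟨by rw [Measure.restrict_apply_univ]; exact (h2 k).lt_top⟩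
  -- The shells partition the space, each has finite intensity, and a bounded region meets only
  -- finitely many of them.
  set ν : ℕ → Measure (E d × Sph d) := fun k => μ.restrict (shell d k) with hν
  have hgood : ∀ᵐ ω ∂blocksLaw ν, ω ∈ goodBlocks d :=
    ae_mem_goodBlocks (fun k z => Measure.restrict_apply_le _ _ |>.trans_eq (h1 z) |> le_zero_iff.1)
      fun k => by simp [hν, Measure.restrict_apply (measurableSet_shell k).compl]
  have hm := measurable_blockConfig (d := d)
  refine ⟨(blocksLaw ν).map blockConfig, Measure.isProbabilityMeasure_map hm.aemeasurable, ?_, ?_⟩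
  · intro B hB hBfin
    rw [Measure.map_map (measurable_count hB) hm]
    refine map_eq_poisson_of_mono (N := fun K => partialCount K B)
      (measurable_count_blockConfig hB) (fun ω => partialCount_mono B ω) ?_
      (r := fun K => ∑ k ∈ Finset.range K, (ν k B).toNNReal) ?_
      fun K m => measure_le_partialCount ν K hB m
    · filter_upwards [hgood] with ω hω m using le_count_blockConfig hω B m
    · have hsum : ∑' k, ν k B = μ B := by
        simp only [hν, Measure.restrict_apply hB]
        rw [← measure_iUnion]
        · rw [← Set.inter_iUnion]
          congr 1
          refine Set.inter_eq_left.2 fun z _ => Set.mem_iUnion.2 ⟨_, rfl⟩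
        · intro i j hij
          refine Set.disjoint_left.2 fun z hz hz' => hij ?_
          exact (show _ = i from hz.2).symm.trans hz'.2
        · exact fun k => hB.inter (measurableSet_shell k)
      have hs := (ENNReal.summable (f := fun k => ν k B)).hasSum.tendsto_sum_nat
      rw [hsum] at hs
      refine ((ENNReal.tendsto_toNNReal hBfin).comp hs).congr fun K => ?_
      exact ENNReal.toNNReal_sum fun k _ => measure_ne_top _ _
  · intro n B hB hd
    have hi : iIndepFun (fun i ω => count (B i) (blockConfig ω)) (blocksLaw ν) :=
      iIndepFun_of_mono (N := fun K i => partialCount K (B i))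
        (fun i => measurable_count_blockConfig (hB i)) (fun i ω => partialCount_mono (B i) ω)
        (by filter_upwards [hgood] with ω hω i m using le_count_blockConfig hω (B i) m)
        fun K => iIndepFun_partialCount ν K hB hd
    rw [iIndepFun_iff_measure_inter_preimage_eq_mul] at hi ⊢
    intro S sets hsets
    have hpre : ∀ i ∈ S, MeasurableSet (count (B i) ⁻¹' sets i) := fun i hi =>
      measurable_count (hB i) (hsets i hi)
    rw [Measure.map_apply hm (S.measurableSet_biInter hpre), Set.preimage_iInter₂,
      Finset.prod_congr rfl fun i hi => Measure.map_apply hm (hpre i hi)]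
    exact hi S hsets

end Existence

/-! ### Independent boxes and their occupation probabilities. -/

section Cells

variable {d : ℕ}

/-- The index of the cell containing a centre, for the partition of `ℝ^d` into boxes with side
lengths `w`. -/
noncomputable def cellIdx (w : Fin d → ℝ) (x : E d) : Fin d → ℤ := fun i => ⌊x i / w i⌋

/-- The pairs (centre, orientation) with centre in the cell with index `v`. -/
def cell (w : Fin d → ℝ) (v : Fin d → ℤ) : Set (E d × Sph d) := {z | cellIdx w z.1 = v}

theorem measurable_cellIdx (w : Fin d → ℝ) : Measurable (cellIdx w) :=
  measurable_pi_lambda _ fun i => Int.measurable_floor.comp (by fun_prop)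

theorem measurableSet_cell (w : Fin d → ℝ) (v : Fin d → ℤ) : MeasurableSet (cell w v) :=
  ((measurable_cellIdx w).comp measurable_fst) (measurableSet_singleton v)

theorem disjoint_cell (w : Fin d → ℝ) {u v : Fin d → ℤ} (h : u ≠ v) :
    Disjoint (cell w u) (cell w v) :=
  Set.disjoint_left.2 fun _ hz hz' => h (hz.symm.trans hz')

theorem volume_cellIdx_preimage {w : Fin d → ℝ} (hw : ∀ i, 0 < w i) (v : Fin d → ℤ) :
    volume (cellIdx w ⁻¹' {v}) = ∏ i, ENNReal.ofReal (w i) := by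
  have h1 : cellIdx w ⁻¹' {v} = (MeasurableEquiv.toLp 2 (Fin d → ℝ)).symm ⁻¹'
      Set.univ.pi fun i => Set.Ico (v i * w i) ((v i + 1) * w i) := by
    ext x
    simp only [Set.mem_preimage, Set.mem_singleton_iff, funext_iff, cellIdx, Set.mem_univ_pi,
      Set.mem_Ico, Int.floor_eq_iff, le_div_iff₀ (hw _), div_lt_iff₀ (hw _)]
    rfl
  rw [h1, (EuclideanSpace.volume_preserving_symm_measurableEquiv_toLp (Fin d)).measure_preimage
    (MeasurableSet.univ_pi fun i => measurableSet_Ico).nullMeasurableSet, volume_pi_pi]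
  refine Finset.prod_congr rfl fun i _ => ?_
  rw [Real.volume_Ico]
  congr 1
  ring

variable (p : Sph d) (lam : ℝ)

theorem intensity_prod_univ (A : Set (E d)) :
    intensity (Measure.dirac p) lam (A ×ˢ Set.univ) = ENNReal.ofReal lam * volume A := by
  rw [intensity, Measure.prod_prod, measure_univ, mul_one, Measure.smul_apply, smul_eq_mul]

theorem intensity_cell {w : Fin d → ℝ} (hw : ∀ i, 0 < w i) (v : Fin d → ℤ) :
    intensity (Measure.dirac p) lam (cell w v) = ENNReal.ofReal (lam * ∏ i, w i) := by
  have : cell w v = (cellIdx w ⁻¹' {v}) ×ˢ Set.univ := by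
    ext z; simp [cell]
  rw [this, intensity_prod_univ, volume_cellIdx_preimage hw,
    ENNReal.ofReal_mul' (Finset.prod_nonneg fun i _ => (hw i).le),
    ENNReal.ofReal_prod_of_nonneg fun i _ => (hw i).le]

theorem intensity_orientation_ne :
    intensity (Measure.dirac p) lam (Set.univ ×ˢ {p}ᶜ) = 0 := by
  rw [intensity, Measure.prod_prod, Measure.dirac_apply' _ (measurableSet_singleton p).compl]
  simp

theorem exists_isPoissonLaw_intensity (hd : 0 < d) :
    ∃ Q : Measure (Config d), IsPoissonLaw (intensity (Measure.dirac p) lam) Q := by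
  -- Positive dimension is what makes Lebesgue measure free of atoms.
  have : Nonempty (Fin d) := ⟨⟨0, hd⟩⟩
  refine exists_isPoissonLaw _ (fun z => ?_) fun k => ?_
  · obtain ⟨x, q⟩ := z
    refine measure_mono_null (t := {x} ×ˢ Set.univ) (by simp) ?_
    rw [intensity_prod_univ, measure_singleton, mul_zero]
  · refine ne_top_of_le_ne_top ?_ (measure_mono (t := Metric.ball (0 : E d) (k + 1) ×ˢ Set.univ) ?_)
    · rw [intensity_prod_univ]
      exact ENNReal.mul_ne_top ENNReal.ofReal_ne_top measure_ball_lt_top.ne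
    · intro z hz
      have hz' : ⌊‖z.1‖⌋₊ = k := hz
      refine ⟨?_, trivial⟩
      rw [mem_ball_zero_iff, ← hz']
      exact Nat.lt_floor_add_one _

variable {p lam} {μ : Measure (E d × Sph d)} {Q : Measure (Config d)}

theorem IsPoissonLaw.measure_count_eq_zero (hQ : IsPoissonLaw μ Q) {B : Set (E d × Sph d)}
    (hB : MeasurableSet B) {a : ℝ} (ha : μ B = ENNReal.ofReal a) (ha0 : 0 ≤ a) :
    Q {ω | count B ω = 0} = ENNReal.ofReal (Real.exp (-a)) := by
  have h := congrArg (fun ρ => ρ {0}) (hQ.map_count B hB (ha ▸ ENNReal.ofReal_ne_top))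
  rw [Measure.map_apply (measurable_count hB) .of_discrete,
    Measure.map_apply .of_discrete .of_discrete] at h
  have h2 : (fun n : ℕ => (n : ℕ∞)) ⁻¹' {0} = {0} := by ext; simp
  rw [h2, poissonMeasure_singleton, ha] at h
  refine h.trans ?_
  rw [ENNReal.coe_toNNReal_eq_toReal, ENNReal.toReal_ofReal ha0]
  simp

theorem IsPoissonLaw.measure_count_ne_zero_le (hQ : IsPoissonLaw μ Q) {B : Set (E d × Sph d)}
    (hB : MeasurableSet B) {a : ℝ} (ha : μ B = ENNReal.ofReal a) (ha0 : 0 ≤ a) :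
    Q {ω | count B ω ≠ 0} ≤ ENNReal.ofReal a := by
  have := hQ.isProbabilityMeasure
  have h1 : {ω | count B ω ≠ 0} = {ω | count B ω = 0}ᶜ := rfl
  have h2 : MeasurableSet {ω : Config d | count B ω = 0} :=
    measurable_count hB (MeasurableSet.of_discrete (s := {0}))
  rw [h1, prob_compl_eq_one_sub h2, hQ.measure_count_eq_zero hB ha ha0, ← ENNReal.ofReal_one,
    ← ENNReal.ofReal_sub _ (Real.exp_pos _).le]
  exact ENNReal.ofReal_le_ofReal (by linarith [Real.add_one_le_exp (-a)])

theorem IsPoissonLaw.measure_forall_cell (hQ : IsPoissonLaw μ Q) (w : Fin d → ℝ)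
    (S : Finset (Fin d → ℤ)) (T : Set ℕ∞) :
    Q {ω | ∀ v ∈ S, count (cell w v) ω ∈ T} = ∏ v ∈ S, Q {ω | count (cell w v) ω ∈ T} := by
  have h1 := hQ.indep_count S.card (fun i => cell w (S.equivFin.symm i))
    (fun i => measurableSet_cell w _) fun i j hij => disjoint_cell w fun h =>
      hij (S.equivFin.symm.injective (Subtype.ext h))
  have h2 := h1.precomp S.equivFin.injective
  simp only [Equiv.symm_apply_apply] at h2
  have h3 := h2.measure_inter_preimage_eq_mul Finset.univ (sets := fun _ => T)
    fun _ _ => .of_discrete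
  rw [← Finset.prod_coe_sort S]
  refine Eq.trans ?_ h3
  congr 1
  ext ω
  simp

theorem IsPoissonLaw.measure_forall_cell_empty
    (hQ : IsPoissonLaw (intensity (Measure.dirac p) lam) Q) (hlam : 0 ≤ lam) {w : Fin d → ℝ}
    (hw : ∀ i, 0 < w i) (S : Finset (Fin d → ℤ)) :
    Q {ω | ∀ v ∈ S, count (cell w v) ω = 0} =
      ENNReal.ofReal (Real.exp (-(lam * ∏ i, w i))) ^ S.card := by
  have ha : 0 ≤ lam * ∏ i, w i := mul_nonneg hlam (Finset.prod_nonneg fun i _ => (hw i).le)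
  refine (hQ.measure_forall_cell w S {0}).trans ?_
  rw [Finset.prod_eq_pow_card fun v _ => ?_]
  exact hQ.measure_count_eq_zero (measurableSet_cell w v) (intensity_cell p lam hw v) ha

theorem IsPoissonLaw.measure_forall_cell_nonempty_le
    (hQ : IsPoissonLaw (intensity (Measure.dirac p) lam) Q) (hlam : 0 ≤ lam) {w : Fin d → ℝ}
    (hw : ∀ i, 0 < w i) (S : Finset (Fin d → ℤ)) :
    Q {ω | ∀ v ∈ S, count (cell w v) ω ≠ 0} ≤ ENNReal.ofReal (lam * ∏ i, w i) ^ S.card := by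
  have ha : 0 ≤ lam * ∏ i, w i := mul_nonneg hlam (Finset.prod_nonneg fun i _ => (hw i).le)
  refine (hQ.measure_forall_cell w S {0}ᶜ).trans_le ?_
  refine Finset.prod_le_pow_card _ _ _ fun v _ => ?_
  exact hQ.measure_count_ne_zero_le (measurableSet_cell w v) (intensity_cell p lam hw v) ha

/-- The pairs with another orientation form a region of intensity zero, which is almost surely
empty. -/
theorem IsPoissonLaw.ae_orientation_eq
    (hQ : IsPoissonLaw (intensity (Measure.dirac p) lam) Q) : ∀ᵐ ω ∂Q, ∀ z ∈ ω.1, z.2 = p := by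
  have := hQ.isProbabilityMeasure
  have hB : MeasurableSet ((Set.univ : Set (E d)) ×ˢ ({p}ᶜ : Set (Sph d))) :=
    MeasurableSet.univ.prod (measurableSet_singleton p).compl
  have h := hQ.measure_count_ne_zero_le hB (a := 0)
    ((intensity_orientation_ne p lam).trans (by simp)) le_rfl
  have h' : ∀ᵐ ω ∂Q, count (Set.univ ×ˢ {p}ᶜ) ω = 0 := by
    rw [ae_iff]; simpa using h
  filter_upwards [h'] with ω hω z hz
  rw [count, Set.encard_eq_zero] at hω
  by_contra hne
  exact (hω ▸ ⟨hz, trivial, hne⟩ : z ∈ (∅ : Set _))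

theorem count_ne_zero_iff {B : Set (E d × Sph d)} {ω : Config d} :
    count B ω ≠ 0 ↔ ∃ z ∈ ω.1, z ∈ B := by
  rw [count, Ne, Set.encard_eq_zero, ← Ne, ← Set.nonempty_iff_ne_empty]
  rfl

end Cells

/-! ### Deterministic renormalisation of planar site percolation. -/

section Renormalisation

/-- Nearest neighbours in the quadrant `ℕ × ℕ`. -/
def SiteAdj (u v : ℕ × ℕ) : Prop :=
  (u.1 = v.1 ∧ (u.2 + 1 = v.2 ∨ v.2 + 1 = u.2)) ∨ (u.2 = v.2 ∧ (u.1 + 1 = v.1 ∨ v.1 + 1 = u.1))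

/-- The sites `u` and `v` are joined by a path of open sites. -/
def SiteConn (g : ℕ × ℕ → Prop) : ℕ × ℕ → ℕ × ℕ → Prop :=
  Relation.ReflTransGen fun u v => SiteAdj u v ∧ g u ∧ g v

/-- `x` is one of the nine sites making up the box `v`. -/
def IsSub (v x : ℕ × ℕ) : Prop := x.1 / 3 = v.1 ∧ x.2 / 3 = v.2

/-- A box is open if at most one of its nine sites is closed. -/
def renorm (g : ℕ × ℕ → Prop) (v : ℕ × ℕ) : Prop :=
  ∀ x y, IsSub v x → IsSub v y → x ≠ y → g x ∨ g y

variable {g : ℕ × ℕ → Prop}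

theorem SiteConn.symm {u v : ℕ × ℕ} (h : SiteConn g u v) : SiteConn g v u := by
  have : Std.Symm fun u v => SiteAdj u v ∧ g u ∧ g v := ⟨fun a b => ?_⟩
  · exact Relation.ReflTransGen.stdSymm.symm _ _ h
  rintro ⟨hab, ha, hb⟩
  refine ⟨?_, hb, ha⟩
  unfold SiteAdj at *
  omega

theorem SiteConn.swap {u v : ℕ × ℕ} (h : SiteConn (fun x => g x.swap) u v) :
    SiteConn g u.swap v.swap := by
  refine Relation.ReflTransGen.lift Prod.swap (fun a b => ?_) _ _ h
  rintro ⟨hab, ha, hb⟩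
  refine ⟨?_, ha, hb⟩
  unfold SiteAdj at *
  simp only [Prod.fst_swap, Prod.snd_swap]
  omega

theorem IsSub.swap {v x : ℕ × ℕ} (h : IsSub v x) : IsSub v.swap x.swap := ⟨h.2, h.1⟩

theorem renorm.swap {v : ℕ × ℕ} (h : renorm g v) : renorm (fun x => g x.swap) v.swap :=
  fun x y hx hy hxy => h x.swap y.swap hx.swap hy.swap fun e => hxy (Prod.swap_injective e)

theorem siteConn_row {m n y : ℕ} (h : ∀ i, m ≤ i → i ≤ n → g (i, y)) {i j : ℕ} (hi : m ≤ i)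
    (hin : i ≤ n) (hj : m ≤ j) (hjn : j ≤ n) : SiteConn g (i, y) (j, y) := by
  have key : ∀ k a, m ≤ a → a + k ≤ n → SiteConn g (a, y) (a + k, y) := by
    intro k
    induction k with
    | zero => exact fun a _ _ => Relation.ReflTransGen.refl
    | succ k ih =>
      intro a ha hk
      refine (ih a ha (by omega)).tail ⟨Or.inr ⟨rfl, Or.inl rfl⟩, h _ (by omega) (by omega),
        h _ (by omega) (by omega)⟩
  rcases le_total i j with hij | hij
  · simpa [Nat.add_sub_cancel' hij] using key (j - i) i hi (by omega)
  · simpa [Nat.add_sub_cancel' hij] using (key (i - j) j hj (by omega)).symm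

/-- All sites in row `y` of the box `v` are open. -/
def RowFull (g : ℕ × ℕ → Prop) (v : ℕ × ℕ) (y : ℕ) : Prop := ∀ i, i / 3 = v.1 → g (i, y)

theorem RowFull.siteConn {v : ℕ × ℕ} {y i j : ℕ} (h : RowFull g v y) (hi : i / 3 = v.1)
    (hj : j / 3 = v.1) : SiteConn g (i, y) (j, y) :=
  siteConn_row (m := 3 * v.1) (n := 3 * v.1 + 2) (fun k _ _ => h k (by omega)) (by omega)
    (by omega) (by omega) (by omega)

/-- Two different rows with a closed site would give two closed sites in the box. -/
theorem renorm.eq_of_not_rowFull {v : ℕ × ℕ} (h : renorm g v) {y z : ℕ} (hy : y / 3 = v.2)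
    (hz : z / 3 = v.2) (h1 : ¬ RowFull g v y) (h2 : ¬ RowFull g v z) : y = z := by
  unfold RowFull at h1 h2
  push Not at h1 h2
  obtain ⟨i, hi, hgi⟩ := h1
  obtain ⟨j, hj, hgj⟩ := h2
  by_contra hne
  rcases h (i, y) (j, z) ⟨hi, hy⟩ ⟨hj, hz⟩ (by simp [hne]) with h3 | h3
  exacts [hgi h3, hgj h3]

theorem renorm.exists_rowFull {v : ℕ × ℕ} (h : renorm g v) : ∃ y, y / 3 = v.2 ∧ RowFull g v y := by
  by_contra! hc
  have := h.eq_of_not_rowFull (y := 3 * v.2) (z := 3 * v.2 + 1) (by omega) (by omega)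
    (hc _ (by omega)) (hc _ (by omega))
  omega

/-- Closed sites in both the row and the column of `x` would have to coincide, hence be `x` itself,
which is open. -/
theorem renorm.rowFull_or {v x : ℕ × ℕ} (h : renorm g v) (hx : IsSub v x) (hg : g x) :
    RowFull g v x.2 ∨ RowFull (fun x => g x.swap) v.swap x.1 := by
  by_contra! hc
  obtain ⟨h1, h2⟩ := hc
  unfold RowFull at h1 h2
  push Not at h1 h2
  obtain ⟨i, hi, hgi⟩ := h1
  obtain ⟨j, hj, hgj⟩ := h2
  simp only [Prod.swap_prod_mk, Prod.fst_swap] at hgj hj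
  by_cases he : (i, x.2) = (x.1, j)
  · simp only [Prod.mk.injEq] at he
    rw [he.1] at hgi
    exact hgi hg
  · rcases h (i, x.2) (x.1, j) ⟨hi, hx.2⟩ ⟨hx.1, hj⟩ he with h3 | h3
    exacts [hgi h3, hgj h3]

theorem renorm.siteConn {v x y : ℕ × ℕ} (h : renorm g v) (hx : IsSub v x) (hy : IsSub v y)
    (hgx : g x) (hgy : g y) : SiteConn g x y := by
  obtain ⟨b, hb, hrow⟩ := h.exists_rowFull
  obtain ⟨a, ha, hcol⟩ := h.swap.exists_rowFull
  -- Every open site reaches the crossing of a full row and a full column, because its own row or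
  -- column is full.
  have key : ∀ x, IsSub v x → g x → SiteConn g x (a, b) := by
    intro x hx hgx
    rcases h.rowFull_or hx hgx with h1 | h1
    · exact (h1.siteConn hx.1 ha).trans (hcol.siteConn (i := x.2) (j := b) hx.2 hb).swap
    · exact (h1.siteConn (i := x.2) (j := b) hx.2 hb).swap.trans (hrow.siteConn hx.1 ha)
  exact (key x hx hgx).trans (key y hy hgy).symm

theorem renorm.siteConn_of_right {v w x y : ℕ × ℕ} (hv : renorm g v) (hw : renorm g w)
    (h1 : v.1 + 1 = w.1) (h2 : v.2 = w.2) (hx : IsSub v x) (hy : IsSub w y) (hgx : g x)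
    (hgy : g y) : SiteConn g x y := by
  -- Each of the two boxes spoils at most one of the three common rows, so one row is full in both.
  have hrow : ∃ b, b / 3 = v.2 ∧ RowFull g v b ∧ RowFull g w b := by
    by_contra! hc
    have e := fun a b ha hb => hv.eq_of_not_rowFull (y := a) (z := b) ha hb
    have f := fun a b ha hb => hw.eq_of_not_rowFull (y := a) (z := b) ha hb
    have c : ∀ b, b / 3 = v.2 → ¬ RowFull g v b ∨ ¬ RowFull g w b := fun b hb => by
      have := hc b hb; tauto
    rcases c (3 * v.2) (by omega) with h3 | h3 <;> rcases c (3 * v.2 + 1) (by omega) with h4 | h4 <;>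
      rcases c (3 * v.2 + 2) (by omega) with h5 | h5 <;> first
      | (have := e _ _ (by omega) (by omega) h3 h4; omega)
      | (have := e _ _ (by omega) (by omega) h4 h5; omega)
      | (have := e _ _ (by omega) (by omega) h3 h5; omega)
      | (have := f _ _ (by omega) (by omega) h3 h4; omega)
      | (have := f _ _ (by omega) (by omega) h4 h5; omega)
      | (have := f _ _ (by omega) (by omega) h3 h5; omega)
  obtain ⟨b, hb, hvb, hwb⟩ := hrow
  have hmid : SiteConn g (3 * v.1, b) (3 * v.1 + 3, b) := by
    refine siteConn_row (m := 3 * v.1) (n := 3 * v.1 + 3) (fun i hi hi' => ?_) (by omega) (by omega)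
      (by omega) (by omega)
    by_cases hi3 : i / 3 = v.1
    · exact hvb i hi3
    · exact hwb i (by omega)
  refine (hv.siteConn (y := (3 * v.1, b)) hx ⟨by simp, hb⟩ hgx (hvb _ (by simp))).trans
    (hmid.trans (hw.siteConn ⟨by simp only; omega, by simp only; omega⟩ hy (hwb _ (by omega)) hgy))

theorem renorm.siteConn_of_adj {v w x y : ℕ × ℕ} (hv : renorm g v) (hw : renorm g w)
    (h : SiteAdj v w) (hx : IsSub v x) (hy : IsSub w y) (hgx : g x) (hgy : g y) :
    SiteConn g x y := by
  rcases h with ⟨h1, h2 | h2⟩ | ⟨h1, h2 | h2⟩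
  · have := hv.swap.siteConn_of_right hw.swap h2 h1 hx.swap hy.swap hgx hgy
    exact this.swap
  · have := hw.swap.siteConn_of_right hv.swap h2 h1.symm hy.swap hx.swap hgy hgx
    exact this.swap.symm
  · exact hv.siteConn_of_right hw h2 h1 hx hy hgx hgy
  · exact (hw.siteConn_of_right hv h2 h1.symm hy hx hgy hgx).symm

/-- Every open box has an open site outside its left column. -/
theorem renorm.exists_sub {v : ℕ × ℕ} (h : renorm g v) :
    ∃ x, IsSub v x ∧ g x ∧ 3 * v.1 + 1 ≤ x.1 := by
  rcases h (3 * v.1 + 1, 3 * v.2) (3 * v.1 + 2, 3 * v.2) ⟨by simp only; omega, by simp⟩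
    ⟨by simp only; omega, by simp⟩ (by simp) with h1 | h1
  · exact ⟨_, ⟨by simp only; omega, by simp⟩, h1, by simp⟩
  · exact ⟨_, ⟨by simp only; omega, by simp⟩, h1, by simp⟩

theorem SiteConn.of_renorm {v w : ℕ × ℕ} (h : SiteConn (renorm g) v w) (hv : renorm g v)
    {x : ℕ × ℕ} (hx : IsSub v x) (hgx : g x) :
    ∀ y, IsSub w y → g y → SiteConn g x y := by
  induction h with
  | refl => exact fun y hy hgy => hv.siteConn hx hy hgx hgy
  | tail _ hbc ih =>
    intro y hy hgy
    obtain ⟨z, hz, hgz, -⟩ := hbc.2.1.exists_sub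
    exact (ih z hz hgz).trans (hbc.2.1.siteConn_of_adj hbc.2.2 hbc.1 hz hy hgz hgy)

/-- Passing from `renorm g` to `g` sends first coordinate `M` to at least `3M + 1`. Avoiding the
left column is what starts the growth from `0`. -/
theorem exists_siteConn_of_forall_renorm (M : ℕ) :
    ∀ g : ℕ × ℕ → Prop, (∀ k, (renorm^[k] g) (0, 0)) →
      ∃ u, M ≤ u.1 ∧ g u ∧ SiteConn g (0, 0) u := by
  induction M with
  | zero => exact fun g h => ⟨(0, 0), le_rfl, h 0, Relation.ReflTransGen.refl⟩
  | succ M ih =>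
    intro g h
    obtain ⟨w, hM, hw, hc⟩ := ih (renorm g) fun k => h (k + 1)
    obtain ⟨u, hu, hgu, hle⟩ := hw.exists_sub
    exact ⟨u, by omega, hgu, hc.of_renorm (h 1) ⟨rfl, rfl⟩ (h 0) u hu hgu⟩

/-- An unbounded cluster of `renorm g` pulls back to one of `g`, so finitely many bad levels do no
harm, except that the cluster may miss the origin. -/
theorem exists_unbounded_siteConn (n : ℕ) :
    ∀ g : ℕ × ℕ → Prop, (∀ k, n ≤ k → (renorm^[k] g) (0, 0)) →
      ∃ x, g x ∧ ∀ M, ∃ u, M ≤ u.1 ∧ g u ∧ SiteConn g x u := by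
  induction n with
  | zero =>
    exact fun g h => ⟨(0, 0), h 0 le_rfl, fun M =>
      exists_siteConn_of_forall_renorm M g fun k => h k k.zero_le⟩
  | succ n ih =>
    intro g h
    obtain ⟨x, hx, hinf⟩ := ih (renorm g) fun k hk => h (k + 1) (by omega)
    obtain ⟨x', hx', hgx', -⟩ := hx.exists_sub
    refine ⟨x', hgx', fun M => ?_⟩
    obtain ⟨u, hM, hu, hc⟩ := hinf M
    obtain ⟨u', hu', hgu', hle⟩ := hu.exists_sub
    exact ⟨u', by omega, hgu', hc.of_renorm hx hx' hgx' u' hu' hgu'⟩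

/-- The nine sites of a box. -/
def subs (v : ℕ × ℕ) : Finset (ℕ × ℕ) :=
  Finset.Ico (3 * v.1) (3 * v.1 + 3) ×ˢ Finset.Ico (3 * v.2) (3 * v.2 + 3)

theorem mem_subs {v x : ℕ × ℕ} : x ∈ subs v ↔ IsSub v x := by
  simp only [subs, Finset.mem_product, Finset.mem_Ico, IsSub]
  omega

theorem card_subs (v : ℕ × ℕ) : (subs v).card = 9 := by
  simp [subs]

/-- A family of sets of sites such that a closed box of level `n` has all its sites closed on some
member of the family. -/
def witnesses : ℕ → ℕ × ℕ → Finset (Finset (ℕ × ℕ))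
  | 0, v => {{v}}
  | n + 1, v => (subs v).offDiag.biUnion fun p =>
      Finset.image₂ (· ∪ ·) (witnesses n p.1) (witnesses n p.2)

/-- Nine sites have `72` ordered pairs of distinct elements, so the cardinalities satisfy `a_{n+1} ≤
72 a_n²`. The factor `81` makes the bound close under squaring. -/
theorem card_witnesses_le (n : ℕ) (v : ℕ × ℕ) : 81 * (witnesses n v).card ≤ 81 ^ 2 ^ n := by
  induction n generalizing v with
  | zero => simp [witnesses]
  | succ n ih =>
    have h1 : ∀ p ∈ (subs v).offDiag,
        (Finset.image₂ (· ∪ ·) (witnesses n p.1) (witnesses n p.2)).card * (81 * 81) ≤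
          (81 ^ 2 ^ n) ^ 2 := by
      intro p _
      refine (Nat.mul_le_mul_right _ (Finset.card_image₂_le _ _ _)).trans ?_
      rw [sq]
      refine le_trans (le_of_eq ?_) (Nat.mul_le_mul (ih p.1) (ih p.2))
      ring
    have h2 : (witnesses (n + 1) v).card * (81 * 81) ≤ 72 * (81 ^ 2 ^ n) ^ 2 := by
      rw [witnesses]
      refine (Nat.mul_le_mul_right _ Finset.card_biUnion_le).trans ?_
      rw [Finset.sum_mul]
      refine (Finset.sum_le_card_nsmul _ _ _ h1).trans_eq ?_
      rw [Finset.offDiag_card, card_subs, smul_eq_mul]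
    rw [pow_succ, pow_mul]
    generalize (81 ^ 2 ^ n) ^ 2 = N at *
    omega

/-- The location of the sites is carried along because it makes the two halves disjoint, so that the
cardinality doubles. -/
theorem mem_witnesses {n : ℕ} {v : ℕ × ℕ} {S : Finset (ℕ × ℕ)} (hS : S ∈ witnesses n v) :
    S.card = 2 ^ n ∧ ∀ x ∈ S, x.1 / 3 ^ n = v.1 ∧ x.2 / 3 ^ n = v.2 := by
  induction n generalizing v S with
  | zero =>
    rw [witnesses, Finset.mem_singleton] at hS
    simp [hS]
  | succ n ih =>
    rw [witnesses, Finset.mem_biUnion] at hS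
    obtain ⟨⟨a, b⟩, hab, hS⟩ := hS
    obtain ⟨ha, hb, hne⟩ := Finset.mem_offDiag.1 hab
    obtain ⟨A, hA, B, hB, rfl⟩ := Finset.mem_image₂.1 hS
    obtain ⟨hA1, hA2⟩ := ih hA
    obtain ⟨hB1, hB2⟩ := ih hB
    rw [mem_subs] at ha hb
    refine ⟨?_, fun x hx => ?_⟩
    · rw [Finset.card_union_of_disjoint, hA1, hB1]
      · ring
      · refine Finset.disjoint_left.2 fun x hx hx' => hne (Prod.ext ?_ ?_)
        · exact (hA2 x hx).1.symm.trans (hB2 x hx').1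
        · exact (hA2 x hx).2.symm.trans (hB2 x hx').2
    · rw [pow_succ, ← Nat.div_div_eq_div_mul, ← Nat.div_div_eq_div_mul]
      rcases Finset.mem_union.1 hx with h | h
      · rw [(hA2 x h).1, (hA2 x h).2]; exact ha
      · rw [(hB2 x h).1, (hB2 x h).2]; exact hb

theorem exists_witness {n : ℕ} {v : ℕ × ℕ} (h : ¬ (renorm^[n] g) v) :
    ∃ S ∈ witnesses n v, ∀ x ∈ S, ¬ g x := by
  induction n generalizing v with
  | zero => exact ⟨{v}, by simp [witnesses], by simpa using h⟩
  | succ n ih =>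
    rw [Function.iterate_succ_apply'] at h
    unfold renorm at h
    push Not at h
    obtain ⟨a, b, ha, hb, hne, hga, hgb⟩ := h
    obtain ⟨A, hA, hA'⟩ := ih hga
    obtain ⟨B, hB, hB'⟩ := ih hgb
    refine ⟨A ∪ B, ?_, fun x hx => ?_⟩
    · rw [witnesses]
      exact Finset.mem_biUnion.2 ⟨(a, b), Finset.mem_offDiag.2 ⟨mem_subs.2 ha, mem_subs.2 hb, hne⟩,
        Finset.mem_image₂_of_mem hA hB⟩
    · rcases Finset.mem_union.1 hx with h | h
      exacts [hA' x h, hB' x h]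

end Renormalisation

/-! ### Overlap of sticks in neighbouring boxes, and the upper bound. -/

section Geometry

variable {d : ℕ}

theorem convex_axis (x : E d) (p : Sph d) (L : ℝ) : Convex ℝ (axis x p L) := by
  rintro _ ⟨s, hs1, hs2, rfl⟩ _ ⟨t, ht1, ht2, rfl⟩ a b ha hb hab
  refine ⟨a * s + b * t, by nlinarith, by nlinarith, ?_⟩
  have h : a • x + b • x = x := by rw [← add_smul, hab, one_smul]
  rw [smul_add, smul_add, smul_smul, smul_smul, add_smul, add_add_add_comm, h]

theorem isPreconnected_stick (x : E d) (p : Sph d) (L : ℝ) : IsPreconnected (stick x p L) :=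
  ((convex_axis x p L).cthickening 1).isPreconnected

theorem axis_subset_stick (x : E d) (p : Sph d) (L : ℝ) : axis x p L ⊆ stick x p L :=
  Metric.self_subset_cthickening _

theorem mem_stick_self (x : E d) (p : Sph d) {L : ℝ} (hL : 0 ≤ L) : x ∈ stick x p L :=
  axis_subset_stick x p L ⟨0, by linarith, by linarith, by simp⟩

theorem stick_subset_occupied {L : ℝ} {ω : Config d} {z : E d × Sph d} (hz : z ∈ ω.1) :
    stick z.1 z.2 L ⊆ occupied L ω := 
  Set.subset_biUnion_of_mem (u := fun z : E d × Sph d => stick z.1 z.2 L) hz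

/-- A stick meeting the component of `x` is contained in it. -/
theorem stick_subset_connectedComponentIn {L : ℝ} {ω : Config d} {z : E d × Sph d} (hz : z ∈ ω.1)
    {x q : E d} (hq : q ∈ connectedComponentIn (occupied L ω) x) (hqz : q ∈ stick z.1 z.2 L) :
    stick z.1 z.2 L ⊆ connectedComponentIn (occupied L ω) x := by
  rw [connectedComponentIn_eq hq]
  exact (isPreconnected_stick _ _ _).subset_connectedComponentIn hqz (stick_subset_occupied hz)

theorem e₂_apply (hd : 2 ≤ d) (i : Fin d) : (e₂ d hd : E d) i = if i.val = 1 then 1 else 0 := by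
  simp [e₂, Fin.ext_iff]

/-- The side lengths of a box with side length `b` in the second direction and `a` in the others. -/
def sides (d : ℕ) (a b : ℝ) (i : Fin d) : ℝ := if i.val = 1 then b else a

theorem sides_pos {a b : ℝ} (ha : 0 < a) (hb : 0 < b) (i : Fin d) : 0 < sides d a b i := by
  unfold sides; split_ifs <;> assumption

theorem prod_sides (hd : 2 ≤ d) (a b : ℝ) : ∏ i, sides d a b i = b * a ^ (d - 1) := by
  rw [← Finset.mul_prod_erase _ _ (Finset.mem_univ (⟨1, hd⟩ : Fin d))]
  have h : ∀ i ∈ Finset.univ.erase (⟨1, hd⟩ : Fin d), sides d a b i = a := by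
    intro i hi
    have : i.val ≠ 1 := fun h => Finset.ne_of_mem_erase hi (Fin.ext h)
    simp [sides, this]
  rw [Finset.prod_congr rfl h, Finset.prod_const, Finset.card_erase_of_mem (Finset.mem_univ _),
    Finset.card_univ, Fintype.card_fin]
  simp [sides]

theorem abs_sub_le_of_cellIdx {w : Fin d → ℝ} (hw : ∀ i, 0 < w i) {x y : E d} {i : Fin d}
    (h : |cellIdx w x i - cellIdx w y i| ≤ 1) : |x i - y i| ≤ 2 * w i := by
  have hx1 := Int.floor_le (x i / w i)
  have hx2 := Int.lt_floor_add_one (x i / w i)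
  have hy1 := Int.floor_le (y i / w i)
  have hy2 := Int.lt_floor_add_one (y i / w i)
  have h' : |((⌊x i / w i⌋ : ℤ) : ℝ) - ((⌊y i / w i⌋ : ℤ) : ℝ)| ≤ 1 := by
    have := (Int.cast_le (R := ℝ)).2 h
    simpa [cellIdx] using this
  rw [abs_le] at h'
  have hxy : |x i / w i - y i / w i| ≤ 2 := by
    rw [abs_le]; constructor <;> linarith [h'.1, h'.2]
  rwa [← sub_div, abs_div, abs_of_pos (hw i), div_le_iff₀ (hw i)] at hxy

theorem stick_inter_nonempty (hd : 2 ≤ d) {L : ℝ} {x y : E d}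
    (h : ∀ i, |x i - y i| ≤ 2 * sides d (1 / (2 * d)) (L / 2) i) :
    (stick x (e₂ d hd) L ∩ stick y (e₂ d hd) L).Nonempty := by
  have hd0 : (0 : ℝ) < d := by exact_mod_cast (by omega : 0 < d)
  have h1 := h ⟨1, hd⟩
  simp only [sides, if_true] at h1
  -- Moving `x` by `t` and `y` by `-t` along `e₂` equalises the second coordinates. The others
  -- differ by at most `1/d`, so the squared distance is at most `d · d⁻² ≤ 1`.
  set t : ℝ := (y ⟨1, hd⟩ - x ⟨1, hd⟩) / 2 with ht
  rw [abs_le] at h1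
  have ht1 : -(L / 2) ≤ t := by rw [ht]; linarith
  have ht2 : t ≤ L / 2 := by rw [ht]; linarith
  refine ⟨x + t • (e₂ d hd : E d), axis_subset_stick _ _ _ ⟨t, ht1, ht2, rfl⟩, ?_⟩
  refine Metric.mem_cthickening_of_dist_le _ (y + (-t) • (e₂ d hd : E d)) _ _
    ⟨-t, by linarith, by linarith, rfl⟩ ?_
  rw [EuclideanSpace.dist_eq, Real.sqrt_le_one]
  have hi : ∀ i : Fin d, dist ((x + t • (e₂ d hd : E d)) i) ((y + (-t) • (e₂ d hd : E d)) i) ^ 2 ≤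
      (1 / d) ^ 2 := by
    intro i
    rw [Real.dist_eq, sq_abs, sq_le_sq, abs_of_pos (a := 1 / (d : ℝ)) (by positivity)]
    simp only [PiLp.add_apply, PiLp.smul_apply, e₂_apply, smul_eq_mul]
    by_cases hi1 : i.val = 1
    · have : i = ⟨1, hd⟩ := Fin.ext hi1
      subst this
      have : x ⟨1, hd⟩ + t * 1 - (y ⟨1, hd⟩ + -t * 1) = 0 := by rw [ht]; ring
      simp only [if_true, this, abs_zero]
      positivity
    · have h2 := h i
      simp only [sides, hi1, if_false] at h2
      simp only [hi1, if_false, mul_zero, add_zero]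
      refine h2.trans (le_of_eq ?_)
      field_simp
  refine (Finset.sum_le_sum fun i _ => hi i).trans ?_
  rw [Finset.sum_const, Finset.card_univ, Fintype.card_fin, nsmul_eq_mul]
  have hd1 : (1 : ℝ) ≤ d := by exact_mod_cast (by omega : 1 ≤ d)
  rw [div_pow, one_pow, sq, mul_one_div, div_mul_cancel_left₀ hd0.ne']
  exact inv_le_one_of_one_le₀ hd1

/-- The site `u` of the quadrant as a cell index in the plane of the first two coordinates. -/
def planeIdx (d : ℕ) (u : ℕ × ℕ) (i : Fin d) : ℤ :=
  if i.val = 0 then u.1 else if i.val = 1 then u.2 else 0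

theorem planeIdx_injective (hd : 2 ≤ d) : Function.Injective (planeIdx d) := by
  intro u v h
  have h0 := congrFun h ⟨0, by omega⟩
  have h1 := congrFun h ⟨1, hd⟩
  simp only [planeIdx, if_true, one_ne_zero, if_false, Nat.cast_inj] at h0 h1
  exact Prod.ext h0 h1

theorem abs_planeIdx_sub_le {u v : ℕ × ℕ} (h : u = v ∨ SiteAdj u v) (i : Fin d) :
    |planeIdx d u i - planeIdx d v i| ≤ 1 := by
  rcases h with rfl | h
  · simp
  · unfold SiteAdj at h
    unfold planeIdx
    rw [abs_le]
    split_ifs <;> constructor <;> omega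

/-- The site `u` is open if its cell contains a point. -/
def SiteOpen (w : Fin d → ℝ) (ω : Config d) (u : ℕ × ℕ) : Prop :=
  count (cell w (planeIdx d u)) ω ≠ 0

theorem stick_subset_of_siteConn (hd : 2 ≤ d) {L : ℝ} (hL : 0 < L) {ω : Config d}
    (hω : ∀ z ∈ ω.1, z.2 = e₂ d hd) {u v : ℕ × ℕ}
    (h : SiteConn (SiteOpen (sides d (1 / (2 * d)) (L / 2)) ω) u v) {z : E d × Sph d}
    (hz : z ∈ ω.1) (hzu : z ∈ cell (sides d (1 / (2 * d)) (L / 2)) (planeIdx d u)) :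
    ∀ z' ∈ ω.1, z' ∈ cell (sides d (1 / (2 * d)) (L / 2)) (planeIdx d v) →
      stick z'.1 z'.2 L ⊆ connectedComponentIn (occupied L ω) z.1 := by
  have hd0 : (0 : ℝ) < d := by exact_mod_cast (by omega : 0 < d)
  have hw := fun i => sides_pos (d := d) (a := 1 / (2 * d)) (b := L / 2) (by positivity)
    (by positivity) i
  -- The case `a = b` is needed because one cell may contain several centres.
  have key : ∀ {a b : ℕ × ℕ}, a = b ∨ SiteAdj a b → ∀ z₁ ∈ ω.1, ∀ z₂ ∈ ω.1,
      z₁ ∈ cell (sides d (1 / (2 * d)) (L / 2)) (planeIdx d a) →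
      z₂ ∈ cell (sides d (1 / (2 * d)) (L / 2)) (planeIdx d b) →
      stick z₁.1 z₁.2 L ⊆ connectedComponentIn (occupied L ω) z.1 →
      stick z₂.1 z₂.2 L ⊆ connectedComponentIn (occupied L ω) z.1 := by
    intro a b hab z₁ h₁ z₂ h₂ hc₁ hc₂ hsub
    have hne : (stick z₁.1 z₁.2 L ∩ stick z₂.1 z₂.2 L).Nonempty := by
      rw [hω z₁ h₁, hω z₂ h₂]
      refine stick_inter_nonempty hd fun i => abs_sub_le_of_cellIdx hw ?_
      rw [show cellIdx _ z₁.1 = _ from hc₁, show cellIdx _ z₂.1 = _ from hc₂]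
      exact abs_planeIdx_sub_le hab i
    obtain ⟨q, hq1, hq2⟩ := hne
    exact stick_subset_connectedComponentIn h₂ (hsub hq1) hq2
  have hself : stick z.1 z.2 L ⊆ connectedComponentIn (occupied L ω) z.1 := by
    have hmem := mem_stick_self z.1 z.2 hL.le
    exact stick_subset_connectedComponentIn hz
      (mem_connectedComponentIn (stick_subset_occupied hz hmem)) hmem
  induction h with
  | refl => exact fun z' hz' hc => key (Or.inl rfl) z hz z' hz' hzu hc hself
  | tail _ hbc ih =>
    intro z' hz' hc
    obtain ⟨z₁, h₁, hc₁⟩ := count_ne_zero_iff.1 hbc.2.1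
    exact key (Or.inr hbc.1) z₁ h₁ z' hz' hc₁ hc (ih z₁ h₁ hc₁)

theorem percolates_of_renorm (hd : 2 ≤ d) {L : ℝ} (hL : 0 < L) {ω : Config d}
    (hω : ∀ z ∈ ω.1, z.2 = e₂ d hd)
    (h : ∀ᶠ k in Filter.atTop,
      (renorm^[k] (SiteOpen (sides d (1 / (2 * d)) (L / 2)) ω)) (0, 0)) : Percolates L ω := by
  have hd0 : (0 : ℝ) < d := by exact_mod_cast (by omega : 0 < d)
  obtain ⟨n, hn⟩ := Filter.eventually_atTop.1 h
  obtain ⟨x, hx, hinf⟩ := exists_unbounded_siteConn n _ hn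
  obtain ⟨z, hz, hzx⟩ := count_ne_zero_iff.1 hx
  refine ⟨z.1, stick_subset_occupied hz (mem_stick_self _ _ hL.le), fun hb => ?_⟩
  obtain ⟨R, hR⟩ := hb.exists_norm_le
  -- Cells have width `1/(2d)` in the first direction, so index at least `M` puts the centre beyond
  -- distance `R`.
  obtain ⟨M, hM⟩ := exists_nat_gt (R * (2 * d))
  obtain ⟨u, hMu, hu, hc⟩ := hinf M
  obtain ⟨z', hz', hzu⟩ := count_ne_zero_iff.1 hu
  have h1 := hR _ (stick_subset_of_siteConn hd hL hω hc hz hzx z' hz' hzu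
    (mem_stick_self _ _ hL.le))
  have h2 : cellIdx (sides d (1 / (2 * d)) (L / 2)) z'.1 ⟨0, by omega⟩ = u.1 :=
    (congrFun (show cellIdx _ z'.1 = _ from hzu) _).trans (by simp [planeIdx])
  have h3 := Int.floor_le (z'.1 ⟨0, by omega⟩ / sides d (1 / (2 * d)) (L / 2) ⟨0, by omega⟩)
  rw [show ⌊_⌋ = _ from h2] at h3
  simp only [sides, zero_ne_one, if_false, div_div_eq_mul_div, div_one, Int.cast_natCast] at h3
  have h4 : z'.1 ⟨0, by omega⟩ ≤ ‖z'.1‖ := (le_abs_self _).trans (PiLp.norm_apply_le z'.1 _)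
  have h5 : (M : ℝ) ≤ u.1 := by exact_mod_cast hMu
  nlinarith

theorem ae_percolates (hd : 2 ≤ d) {L lam : ℝ} (hL : 0 < L) (hlam : 0 ≤ lam)
    (ha : 6 ≤ lam * (L / 2 * (1 / (2 * d)) ^ (d - 1))) {Q : Measure (Config d)}
    (hQ : IsPoissonLaw (intensity (Measure.dirac (e₂ d hd)) lam) Q) :
    ∀ᵐ ω ∂Q, Percolates L ω := by
  have hd0 : (0 : ℝ) < d := by exact_mod_cast (by omega : 0 < d)
  set w := sides d (1 / (2 * d)) (L / 2) with hw
  have hwpos : ∀ i, 0 < w i := fun i => sides_pos (by positivity) (by positivity) i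
  -- A mean of `6` suffices since `e⁶ ≥ 162 = 2 · 81`, where `81` is the growth rate of the number
  -- of witnesses.
  have hq : (81 : ℝ≥0∞) * ENNReal.ofReal (Real.exp (-(lam * ∏ i, w i))) ≤ 2⁻¹ := by
    have h1 : Real.exp (-(lam * ∏ i, w i)) ≤ 1 / 162 := by
      rw [hw, prod_sides hd, Real.exp_neg, ← one_div]
      refine one_div_le_one_div_of_le (by norm_num) ?_
      refine le_trans ?_ (Real.exp_le_exp.2 ha)
      have h6 : Real.exp 6 = Real.exp 1 ^ 6 := by rw [← Real.exp_nat_mul]; norm_num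
      rw [h6]
      calc (162 : ℝ) ≤ 2.7 ^ 6 := by norm_num
        _ ≤ _ := pow_le_pow_left₀ (by norm_num) (by linarith [Real.exp_one_gt_d9]) 6
    have h2 : (81 : ℝ≥0∞) = ENNReal.ofReal 81 := by simp
    have h3 : (2⁻¹ : ℝ≥0∞) = ENNReal.ofReal 2⁻¹ := by
      rw [ENNReal.ofReal_inv_of_pos (by norm_num)]; simp
    rw [h2, h3, ← ENNReal.ofReal_mul (by norm_num)]
    exact ENNReal.ofReal_le_ofReal (by linarith)
  -- Union bound over the witnesses, each consisting of `2^n` distinct and hence independent cells.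
  -- The result is summable in `n`.
  have hbound : ∀ n : ℕ, Q {ω | ¬ (renorm^[n] (SiteOpen w ω)) (0, 0)} ≤ 2⁻¹ ^ n := by
    intro n
    have hsub : {ω | ¬ (renorm^[n] (SiteOpen w ω)) (0, 0)} ⊆ ⋃ S ∈ witnesses n (0, 0),
        {ω | ∀ v ∈ S.image (planeIdx d), count (cell w v) ω = 0} := by
      intro ω hω
      obtain ⟨S, hS, hS'⟩ := exists_witness hω
      refine Set.mem_biUnion hS ?_
      intro v hv
      obtain ⟨x, hx, rfl⟩ := Finset.mem_image.1 hv
      exact not_not.1 (hS' x hx)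
    refine (measure_mono hsub).trans ((measure_biUnion_finset_le _ _).trans ?_)
    have hS : ∀ S ∈ witnesses n (0, 0),
        Q {ω | ∀ v ∈ S.image (planeIdx d), count (cell w v) ω = 0} ≤
          ENNReal.ofReal (Real.exp (-(lam * ∏ i, w i))) ^ 2 ^ n := by
      intro S hS
      rw [hQ.measure_forall_cell_empty hlam hwpos,
        Finset.card_image_of_injective _ (planeIdx_injective hd), (mem_witnesses hS).1]
    refine (Finset.sum_le_card_nsmul _ _ _ hS).trans ?_
    have hcard : ((witnesses n (0, 0)).card : ℝ≥0∞) ≤ 81 ^ 2 ^ n := by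
      have := card_witnesses_le n (0, 0)
      exact_mod_cast (by omega : (witnesses n (0, 0)).card ≤ 81 ^ 2 ^ n)
    rw [nsmul_eq_mul]
    calc _ ≤ (81 : ℝ≥0∞) ^ 2 ^ n * ENNReal.ofReal (Real.exp (-(lam * ∏ i, w i))) ^ 2 ^ n := by
          gcongr
      _ = (81 * ENNReal.ofReal (Real.exp (-(lam * ∏ i, w i)))) ^ 2 ^ n := (mul_pow _ _ _).symm
      _ ≤ 2⁻¹ ^ 2 ^ n := by gcongr
      _ ≤ 2⁻¹ ^ n := pow_le_pow_right_of_le_one' (by simp) Nat.lt_two_pow_self.le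
  have hsum : ∑' n : ℕ, Q {ω | ¬ (renorm^[n] (SiteOpen w ω)) (0, 0)} ≠ ∞ := by
    refine ne_top_of_le_ne_top ?_ (ENNReal.tsum_le_tsum hbound)
    rw [ENNReal.tsum_geometric]
    simp
  filter_upwards [ae_eventually_notMem hsum, hQ.ae_orientation_eq] with ω h1 h2
  exact percolates_of_renorm hd hL h2 (h1.mono fun n hn => not_not.1 hn)

theorem exists_percolating_law (hd : 2 ≤ d) {L : ℝ} (hL : 0 < L) :
    ∃ Q : Measure (Config d),
      IsPoissonLaw (intensity (Measure.dirac (e₂ d hd)) (12 * (2 * d) ^ (d - 1) * L⁻¹)) Q ∧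
        ∀ᵐ ω ∂Q, Percolates L ω := by
  have hd0 : (0 : ℝ) < d := by exact_mod_cast (by omega : 0 < d)
  obtain ⟨Q, hQ⟩ := exists_isPoissonLaw_intensity (e₂ d hd) (12 * (2 * d) ^ (d - 1) * L⁻¹)
    (by omega)
  refine ⟨Q, hQ, ae_percolates hd hL (by positivity) (le_of_eq ?_) hQ⟩
  -- The intensity is chosen so that the mean number of centres per cell is exactly `6`.
  rw [div_pow, one_pow]
  field_simp
  norm_num

end Geometry

/-! ### Counting chains of boxes, and the lower bound. -/

section Subcritical

variable {d : ℕ}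

/-- Cell indices that differ by at most two in each coordinate. -/
def Near (u v : Fin d → ℤ) : Prop := ∀ i, |u i - v i| ≤ 2

theorem Near.symm {u v : Fin d → ℤ} (h : Near u v) : Near v u := fun i => by
  rw [abs_sub_comm]; exact h i

/-- The indices near `v`. -/
noncomputable def nearFinset (v : Fin d → ℤ) : Finset (Fin d → ℤ) :=
  Fintype.piFinset fun i => Finset.Icc (v i - 2) (v i + 2)

theorem mem_nearFinset {u v : Fin d → ℤ} : u ∈ nearFinset v ↔ Near v u := by
  simp only [nearFinset, Fintype.mem_piFinset, Finset.mem_Icc, Near, abs_le]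
  exact forall_congr' fun i => by omega

theorem card_nearFinset (v : Fin d → ℤ) : (nearFinset v).card = 5 ^ d := by
  have h : ∀ i, (Finset.Icc (v i - 2) (v i + 2)).card = 5 := fun i => by
    rw [Int.card_Icc]; omega
  simp [nearFinset, Fintype.card_piFinset, h]

/-- The sequences of `n + 1` indices starting at `v` in which consecutive indices are near. -/
noncomputable def chains : ℕ → (Fin d → ℤ) → Finset (List (Fin d → ℤ))
  | 0, v => {[v]}
  | n + 1, v => (nearFinset v).biUnion fun u => (chains n u).image (List.cons v)

theorem card_chains_le (n : ℕ) (v : Fin d → ℤ) : (chains n v).card ≤ (5 ^ d) ^ n := by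
  induction n generalizing v with
  | zero => simp [chains]
  | succ n ih =>
    rw [chains]
    refine (Finset.card_biUnion_le_card_mul _ _ ((5 ^ d) ^ n) fun u _ =>
      Finset.card_image_le.trans (ih u)).trans_eq ?_
    rw [card_nearFinset, pow_succ, mul_comm]

theorem length_of_mem_chains {n : ℕ} {v : Fin d → ℤ} {l : List (Fin d → ℤ)}
    (h : l ∈ chains n v) : l.length = n + 1 := by
  induction n generalizing v l with
  | zero => simp only [chains, Finset.mem_singleton] at h; simp [h]
  | succ n ih =>
    simp only [chains, Finset.mem_biUnion, Finset.mem_image] at h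
    obtain ⟨u, -, l', hl', rfl⟩ := h
    simp [ih hl']

theorem mem_chains {v : Fin d → ℤ} {l : List (Fin d → ℤ)} (h : List.IsChain Near (v :: l)) :
    v :: l ∈ chains l.length v := by
  induction l generalizing v with
  | nil => simp [chains]
  | cons u l ih =>
    rw [List.isChain_cons_cons] at h
    simp only [List.length_cons, chains, Finset.mem_biUnion, Finset.mem_image]
    exact ⟨u, mem_nearFinset.2 h.1, u :: l, ih h.2, rfl⟩

/-- The graph of near pairs of nonempty cells. -/
def cellGraph (w : Fin d → ℝ) (ω : Config d) : SimpleGraph (Fin d → ℤ) where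
  Adj u v := u ≠ v ∧ Near u v ∧ count (cell w u) ω ≠ 0 ∧ count (cell w v) ω ≠ 0
  symm := ⟨fun _ _ h => ⟨h.1.symm, h.2.1.symm, h.2.2.2, h.2.2.1⟩⟩
  loopless := ⟨fun _ h => h.1 rfl⟩

theorem walk_support_mem_chains {w : Fin d → ℝ} {ω : Config d} {u v : Fin d → ℤ}
    (p : (cellGraph w ω).Walk u v) : p.support ∈ chains p.length u := by
  have h : List.IsChain Near p.support := p.isChain_adj_support.imp fun _ _ h => h.2.1
  have hl := p.length_support
  rw [← p.cons_tail_support] at h hl ⊢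
  rw [List.length_cons, Nat.add_right_cancel_iff] at hl
  exact hl ▸ mem_chains h

theorem walk_support_nonempty {w : Fin d → ℝ} {ω : Config d} {u v : Fin d → ℤ}
    (hu : count (cell w u) ω ≠ 0) (p : (cellGraph w ω).Walk u v) :
    ∀ x ∈ p.support, count (cell w x) ω ≠ 0 := by
  induction p with
  | nil => simpa using hu
  | cons h p ih =>
    intro x hx
    rcases List.mem_cons.1 hx with rfl | hx
    exacts [hu, ih h.2.2.2 x hx]

/-- A finite cluster, or else self-avoiding chains of nonempty cells of any length. -/
theorem finite_reachable_or {w : Fin d → ℝ} {ω : Config d} {v : Fin d → ℤ}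
    (hv : count (cell w v) ω ≠ 0) (n : ℕ)
    (h : ¬ ∃ l ∈ chains n v, l.Nodup ∧ ∀ u ∈ l, count (cell w u) ω ≠ 0) :
    {u | (cellGraph w ω).Reachable v u}.Finite := by
  refine (Set.Finite.biUnion (Finset.range n).finite_toSet fun m _ =>
    ((chains m v).finite_toSet.image fun l => l.getLastD v)).subset ?_
  intro u hu
  obtain ⟨p, hp⟩ := SimpleGraph.Reachable.exists_isPath hu
  -- Paths shorter than `n` end at one of finitely many endpoints of chains; a longer path cut after
  -- `n` steps is a chain excluded by `h`. The default value in `getLastD` is never used.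
  rcases lt_or_ge p.length n with hlt | hge
  · refine Set.mem_biUnion (Finset.mem_coe.2 (Finset.mem_range.2 hlt))
      ⟨p.support, walk_support_mem_chains p, ?_⟩
    have := p.getLast_support
    simp [List.getLastD_eq_getLast?, List.getLast?_eq_getLast_of_ne_nil p.support_ne_nil, this]
  · refine absurd ⟨(p.take n).support, ?_, (hp.take n).support_nodup,
      walk_support_nonempty hv _⟩ h
    have := walk_support_mem_chains (p.take n)
    rwa [SimpleGraph.Walk.take_length, min_eq_left hge] at this

/-- A union bound over chains. Self-avoidance makes the `n + 1` cells distinct, so their occupation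
probabilities multiply. -/
theorem measure_chain_le {p : Sph d} {lam : ℝ} (hlam : 0 ≤ lam) {Q : Measure (Config d)}
    (hQ : IsPoissonLaw (intensity (Measure.dirac p) lam) Q) {w : Fin d → ℝ} (hw : ∀ i, 0 < w i)
    (n : ℕ) (v : Fin d → ℤ) :
    Q {ω | ∃ l ∈ chains n v, l.Nodup ∧ ∀ u ∈ l, count (cell w u) ω ≠ 0} ≤
      (5 ^ d) ^ n * ENNReal.ofReal (lam * ∏ i, w i) ^ (n + 1) := by
  classical
  have hsub : {ω | ∃ l ∈ chains n v, l.Nodup ∧ ∀ u ∈ l, count (cell w u) ω ≠ 0} ⊆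
      ⋃ l ∈ (chains n v).filter List.Nodup, {ω | ∀ u ∈ l.toFinset, count (cell w u) ω ≠ 0} := by
    rintro ω ⟨l, hl, hnd, hopen⟩
    exact Set.mem_biUnion (Finset.mem_coe.2 (Finset.mem_filter.2 ⟨hl, hnd⟩))
      fun u hu => hopen u (List.mem_toFinset.1 hu)
  refine (measure_mono hsub).trans ((measure_biUnion_finset_le _ _).trans ?_)
  have hl : ∀ l ∈ (chains n v).filter List.Nodup,
      Q {ω | ∀ u ∈ l.toFinset, count (cell w u) ω ≠ 0} ≤
        ENNReal.ofReal (lam * ∏ i, w i) ^ (n + 1) := by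
    intro l hl
    obtain ⟨hl, hnd⟩ := Finset.mem_filter.1 hl
    refine (hQ.measure_forall_cell_nonempty_le hlam hw l.toFinset).trans_eq ?_
    rw [List.toFinset_card_of_nodup hnd, length_of_mem_chains hl]
  refine (Finset.sum_le_card_nsmul _ _ _ hl).trans ?_
  rw [nsmul_eq_mul]
  gcongr
  exact_mod_cast (Finset.card_filter_le _ _).trans (card_chains_le n v)

theorem ae_finite_reachable {p : Sph d} {lam : ℝ} (hlam : 0 ≤ lam) {Q : Measure (Config d)}
    (hQ : IsPoissonLaw (intensity (Measure.dirac p) lam) Q) {w : Fin d → ℝ} (hw : ∀ i, 0 < w i)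
    (ha : lam * ∏ i, w i < (5 ^ d)⁻¹) :
    ∀ᵐ ω ∂Q, ∀ v, count (cell w v) ω ≠ 0 → {u | (cellGraph w ω).Reachable v u}.Finite := by
  rw [ae_all_iff]
  intro v
  have hr : (5 ^ d : ℝ≥0∞) * ENNReal.ofReal (lam * ∏ i, w i) < 1 := by
    have h5 : (5 ^ d : ℝ≥0∞) = ENNReal.ofReal (5 ^ d) := by
      rw [ENNReal.ofReal_pow (by norm_num)]; simp
    rw [h5, ← ENNReal.ofReal_mul (by positivity), ENNReal.ofReal_lt_one]
    calc (5 : ℝ) ^ d * (lam * ∏ i, w i) < 5 ^ d * (5 ^ d)⁻¹ := by gcongr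
      _ = 1 := mul_inv_cancel₀ (by positivity)
  have hr1 : ENNReal.ofReal (lam * ∏ i, w i) ≤ 1 := by
    refine ENNReal.ofReal_le_one.2 (ha.le.trans (inv_le_one_of_one_le₀ (one_le_pow₀ (by norm_num))))
  have h0 : Q {ω | ∀ n, ∃ l ∈ chains n v, l.Nodup ∧ ∀ u ∈ l, count (cell w u) ω ≠ 0} = 0 := by
    refine le_antisymm (ge_of_tendsto' (ENNReal.tendsto_pow_atTop_nhds_zero_of_lt_one hr)
      fun n => ?_) zero_le
    refine le_trans (measure_mono ?_) ((measure_chain_le hlam hQ hw n v).trans ?_)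
    · exact fun ω hω => hω n
    rw [mul_pow, pow_succ, ← mul_assoc]
    exact mul_le_of_le_one_right' hr1
  rw [← compl_mem_ae_iff] at h0
  filter_upwards [h0] with ω hω hv
  simp only [Set.mem_compl_iff, Set.mem_ofPred_eq, not_forall] at hω
  obtain ⟨n, hn⟩ := hω
  exact finite_reachable_or hv n hn

theorem isCompact_axis (x : E d) (p : Sph d) (L : ℝ) : IsCompact (axis x p L) := by
  have : axis x p L = (fun t : ℝ => x + t • (p : E d)) '' Set.Icc (-(L / 2)) (L / 2) := by
    ext y
    constructor
    · rintro ⟨t, h1, h2, rfl⟩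
      exact ⟨t, ⟨h1, h2⟩, rfl⟩
    · rintro ⟨t, ⟨h1, h2⟩, rfl⟩
      exact ⟨t, h1, h2, rfl⟩
  rw [this]
  exact isCompact_Icc.image (by fun_prop)

theorem mem_stick_iff {x q : E d} {p : Sph d} {L : ℝ} :
    q ∈ stick x p L ↔ ∃ t : ℝ, |t| ≤ L / 2 ∧ dist q (x + t • (p : E d)) ≤ 1 := by
  rw [stick, (isCompact_axis x p L).cthickening_eq_biUnion_closedBall zero_le_one]
  simp only [Set.mem_iUnion, Metric.mem_closedBall, exists_prop]
  constructor
  · rintro ⟨_, ⟨t, h1, h2, rfl⟩, h⟩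
    exact ⟨t, abs_le.2 ⟨h1, h2⟩, h⟩
  · rintro ⟨t, ht, h⟩
    exact ⟨_, ⟨t, (abs_le.1 ht).1, (abs_le.1 ht).2, rfl⟩, h⟩

theorem dist_le_of_mem_stick {x q : E d} {p : Sph d} {L : ℝ} (h : q ∈ stick x p L) :
    dist q x ≤ 1 + L / 2 := by
  obtain ⟨t, ht, hq⟩ := mem_stick_iff.1 h
  have hp : ‖(p : E d)‖ = 1 := mem_sphere_zero_iff_norm.1 p.2
  have h1 : dist (x + t • (p : E d)) x ≤ L / 2 := by
    rw [dist_eq_norm, add_sub_cancel_left, norm_smul, hp, mul_one]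
    exact ht
  linarith [dist_triangle q (x + t • (p : E d)) x]

theorem isClosed_biUnion_stick {ω : Config d} {T : Set (E d × Sph d)} (hT : T ⊆ ω.1) (L : ℝ) :
    IsClosed (⋃ z ∈ T, stick z.1 z.2 L) := by
  rw [Set.biUnion_eq_iUnion]
  refine LocallyFinite.isClosed_iUnion (fun q => ?_) fun z => Metric.isClosed_cthickening
  refine ⟨Metric.ball q 1, Metric.ball_mem_nhds q one_pos, ?_⟩
  -- A stick meeting the unit ball at `q` has its centre within `1 + (1 + L/2)` of `q`.
  refine ((ω.2 (Metric.closedBall q (2 + L / 2)) Metric.isBounded_closedBall).preimage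
    Subtype.val_injective.injOn).subset ?_
  rintro z ⟨r, hrz, hrq⟩
  refine ⟨hT z.2, ?_, trivial⟩
  have h1 := dist_le_of_mem_stick hrz
  rw [Metric.mem_ball] at hrq
  rw [Metric.mem_closedBall, dist_comm]
  linarith [dist_triangle_left q (z : E d × Sph d).1 r]

theorem isBounded_cellIdx_preimage {w : Fin d → ℝ} (hw : ∀ i, 0 < w i) (v : Fin d → ℤ) :
    Bornology.IsBounded (cellIdx w ⁻¹' {v}) := by
  refine ((PiLp.antilipschitzWith_ofLp 2 fun _ : Fin d => ℝ).isBounded_preimage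
    (Metric.isBounded_Icc (fun i => v i * w i) fun i => (v i + 1) * w i)).subset ?_
  intro x hx
  have h : ∀ i, (v i : ℝ) * w i ≤ x i ∧ x i ≤ (v i + 1) * w i := by
    intro i
    have := Int.floor_eq_iff.1 (congrFun hx i)
    rw [le_div_iff₀ (hw i), div_lt_iff₀ (hw i)] at this
    exact ⟨this.1, this.2.le⟩
  exact ⟨fun i => (h i).1, fun i => (h i).2⟩

/-- The two axes have points within distance `2`. Hence the centres differ by at most `2`
transversally and by at most `L + 2 ≤ 2L` along `e₂`: two side lengths in every direction. -/
theorem near_of_mem_stick (hd : 2 ≤ d) {L : ℝ} (hL : 2 ≤ L) {x y q : E d}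
    (hx : q ∈ stick x (e₂ d hd) L) (hy : q ∈ stick y (e₂ d hd) L) :
    Near (cellIdx (sides d 1 L) x) (cellIdx (sides d 1 L) y) := by
  obtain ⟨s, hs, hqs⟩ := mem_stick_iff.1 hx
  obtain ⟨t, ht, hqt⟩ := mem_stick_iff.1 hy
  rw [abs_le] at hs ht
  intro i
  have hwi : 0 < sides d 1 L i := sides_pos one_pos (by linarith) i
  have h1 : |(x + s • (e₂ d hd : E d)) i - (y + t • (e₂ d hd : E d)) i| ≤ 2 := by
    refine (PiLp.norm_apply_le (x + s • (e₂ d hd : E d) - (y + t • (e₂ d hd : E d))) i).trans ?_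
    rw [← dist_eq_norm]
    linarith [dist_triangle_left (x + s • (e₂ d hd : E d)) (y + t • (e₂ d hd : E d)) q]
  have h2 : |x i - y i| ≤ 2 * sides d 1 L i := by
    simp only [PiLp.add_apply, PiLp.smul_apply, e₂_apply, smul_eq_mul] at h1
    unfold sides
    rw [abs_le] at h1 ⊢
    split_ifs at h1 ⊢ <;> constructor <;> linarith [h1.1, h1.2]
  have h3 : |x i / sides d 1 L i - y i / sides d 1 L i| ≤ 2 := by
    rwa [← sub_div, abs_div, abs_of_pos hwi, div_le_iff₀ hwi]
  rw [abs_le] at h3 ⊢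
  have hx1 := Int.floor_le (x i / sides d 1 L i)
  have hx2 := Int.lt_floor_add_one (x i / sides d 1 L i)
  have hy1 := Int.floor_le (y i / sides d 1 L i)
  have hy2 := Int.lt_floor_add_one (y i / sides d 1 L i)
  unfold cellIdx
  generalize ⌊x i / sides d 1 L i⌋ = a at *
  generalize ⌊y i / sides d 1 L i⌋ = b at *
  have h4 : b - a < 3 := by
    have : (b : ℝ) - a < 3 := by linarith [h3.1]
    exact_mod_cast this
  have h5 : a - b < 3 := by
    have : (a : ℝ) - b < 3 := by linarith [h3.2]
    exact_mod_cast this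
  omega

/-- The sticks with centres in the cell cluster of `x` and the remaining sticks form two disjoint
sets, both closed by local finiteness. The component of `x` lies in the former, a finite union of
bounded sticks. -/
theorem not_percolates_of_finite (hd : 2 ≤ d) {L : ℝ} (hL : 2 ≤ L) {ω : Config d}
    (hω : ∀ z ∈ ω.1, z.2 = e₂ d hd)
    (hfin : ∀ v, count (cell (sides d 1 L) v) ω ≠ 0 →
      {u | (cellGraph (sides d 1 L) ω).Reachable v u}.Finite) : ¬ Percolates L ω := by
  rintro ⟨x, hx, hunb⟩
  set w := sides d 1 L with hw
  have hwpos : ∀ i, 0 < w i := fun i => sides_pos one_pos (by linarith) i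
  have hopen : ∀ z ∈ ω.1, count (cell w (cellIdx w z.1)) ω ≠ 0 := fun z hz =>
    count_ne_zero_iff.2 ⟨z, hz, rfl⟩
  obtain ⟨z₀, hz₀, hxz⟩ := Set.mem_iUnion₂.1 hx
  set C : Set (Fin d → ℤ) := {u | (cellGraph w ω).Reachable (cellIdx w z₀.1) u} with hC
  have hCfin : C.Finite := hfin _ (hopen z₀ hz₀)
  set T : Set (E d × Sph d) := {z ∈ ω.1 | cellIdx w z.1 ∈ C} with hT
  set T' : Set (E d × Sph d) := {z ∈ ω.1 | cellIdx w z.1 ∉ C} with hT'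
  have hTfin : T.Finite := by
    refine (ω.2 (⋃ v ∈ C, cellIdx w ⁻¹' {v}) ((Bornology.isBounded_biUnion hCfin).2 fun v _ =>
      isBounded_cellIdx_preimage hwpos v)).subset ?_
    rintro z ⟨hz, hzC⟩
    exact ⟨hz, Set.mem_biUnion hzC rfl, trivial⟩
  have hbdd : Bornology.IsBounded (⋃ z ∈ T, stick z.1 z.2 L) :=
    (Bornology.isBounded_biUnion hTfin).2 fun z _ => (isCompact_axis _ _ _).isBounded.cthickening
  have hdisj : (⋃ z ∈ T, stick z.1 z.2 L) ∩ (⋃ z ∈ T', stick z.1 z.2 L) = ∅ := by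
    rw [Set.eq_empty_iff_forall_notMem]
    rintro q ⟨hq, hq'⟩
    obtain ⟨z, ⟨hz, hzC⟩, hqz⟩ := Set.mem_iUnion₂.1 hq
    obtain ⟨z', ⟨hz', hzC'⟩, hqz'⟩ := Set.mem_iUnion₂.1 hq'
    rw [hω z hz] at hqz
    rw [hω z' hz'] at hqz'
    refine hzC' (SimpleGraph.Reachable.trans hzC (SimpleGraph.Adj.reachable
      ⟨fun h => hzC' (h ▸ hzC), near_of_mem_stick hd hL hqz hqz', hopen z hz, hopen z' hz'⟩))
  have hcover : connectedComponentIn (occupied L ω) x ⊆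
      (⋃ z ∈ T, stick z.1 z.2 L) ∪ ⋃ z ∈ T', stick z.1 z.2 L := by
    intro q hq
    obtain ⟨z, hz, hqz⟩ := Set.mem_iUnion₂.1 (connectedComponentIn_subset _ _ hq)
    by_cases h : cellIdx w z.1 ∈ C
    · exact Or.inl (Set.mem_biUnion (⟨hz, h⟩ : z ∈ T) hqz)
    · exact Or.inr (Set.mem_biUnion (⟨hz, h⟩ : z ∈ T') hqz)
  have hxT : x ∈ ⋃ z ∈ T, stick z.1 z.2 L :=
    Set.mem_biUnion (⟨hz₀, SimpleGraph.Reachable.refl _⟩ : z₀ ∈ T) hxz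
  rcases isPreconnected_iff_subset_of_disjoint_closed.1 isPreconnected_connectedComponentIn _ _
    (isClosed_biUnion_stick (ω := ω) (fun z hz => hz.1) L)
    (isClosed_biUnion_stick (ω := ω) (fun z hz => hz.1) L) hcover
    (by rw [hdisj, Set.inter_empty]) with h | h
  · exact hunb (hbdd.subset h)
  · exact (hdisj ▸ ⟨hxT, h (mem_connectedComponentIn hx)⟩ : x ∈ (∅ : Set (E d)))

theorem inv_le_of_ae_percolates (hd : 2 ≤ d) {L lam : ℝ} (hL : 2 ≤ L) (hlam : 0 ≤ lam)
    {Q : Measure (Config d)} (hQ : IsPoissonLaw (intensity (Measure.dirac (e₂ d hd)) lam) Q)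
    (hperc : ∀ᵐ ω ∂Q, Percolates L ω) : (5 ^ d)⁻¹ * L⁻¹ ≤ lam := by
  by_contra! hlt
  have hL0 : 0 < L := by linarith
  have := hQ.isProbabilityMeasure
  have ha : lam * ∏ i, sides d 1 L i < (5 ^ d)⁻¹ := by
    rw [prod_sides hd, one_pow, mul_one]
    calc lam * L < (5 ^ d)⁻¹ * L⁻¹ * L := by gcongr
      _ = (5 ^ d)⁻¹ := inv_mul_cancel_right₀ hL0.ne' _
  have hfalse : ∀ᵐ ω ∂Q, False := by
    filter_upwards [hperc, hQ.ae_orientation_eq,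
      ae_finite_reachable hlam hQ (fun i => sides_pos one_pos hL0 i) ha] with ω h1 h2 h3
    exact not_percolates_of_finite hd hL h2 h3 h1
  exact hfalse.exists.choose_spec

end Subcritical

end PoissonStick

theorem theorem2 (d : ℕ) (hd : 2 ≤ d) :
    ∃ c C : ℝ, 0 < c ∧ c < C ∧ ∃ L₀ : ℝ, ∀ L : ℝ, L₀ ≤ L →
      c * L⁻¹ ≤ PoissonStick.lambdaCr d hd L ∧ PoissonStick.lambdaCr d hd L ≤ C * L⁻¹ := by
  have hd1 : (1 : ℝ) ≤ 2 * d := by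
    have : (1 : ℝ) ≤ d := by exact_mod_cast (by omega : 1 ≤ d)
    linarith
  have h1 : (1 : ℝ) ≤ (2 * d) ^ (d - 1) := one_le_pow₀ hd1
  have h2 : ((5 : ℝ) ^ d)⁻¹ ≤ 1 := inv_le_one_of_one_le₀ (one_le_pow₀ (by norm_num))
  -- `5^d` counts the near cells, the second constant gives mean `6` per cell, and `L ≥ 2` is what
  -- `near_of_mem_stick` requires.
  refine ⟨(5 ^ d)⁻¹, 12 * (2 * d) ^ (d - 1), by positivity, by linarith, 2, fun L hL => ?_⟩
  have hL0 : 0 < L := by linarith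
  have hmem : 0 < 12 * (2 * (d : ℝ)) ^ (d - 1) * L⁻¹ := by positivity
  -- The percolating law serves twice: as nonemptiness for the lower bound and as a member for the
  -- upper one.
  refine ⟨le_csInf ⟨_, hmem, PoissonStick.exists_percolating_law hd hL0⟩ ?_,
    csInf_le ⟨0, fun x hx => hx.1.le⟩ ⟨hmem, PoissonStick.exists_percolating_law hd hL0⟩⟩
  rintro lam ⟨hlam, Q, hQ, hperc⟩
  exact PoissonStick.inv_le_of_ae_percolates hd hL hlam.le hQ hperc
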